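/- Let $\mathcal O$ be a complete discrete valuation ring with maximal ideal $\mathfrak m$, let $\Lambda_n=\mathcal O/\mathfrak m^{n+1}$, and let $\mathcal X$ be a topos (sheaves of sets on a small site). Let $\mathrm{Mod}(\mathcal X^{\mathbb N},\Lambda_\bullet)$ be the abelian category of modules over the ring $\Lambda_\bullet=(\Lambda_n)_{n\ge 0}$ in the topos of projective systems of sheaves on $\mathcal X$: an object $M$ is a projective system $(M_n)_{n\ge 0}$ with $M_n$ a sheaf of $\Lambda_n$-modules on $\mathcal X$ and with $\Lambda_{n+1}$-linear transition maps $M_{n+1}\to M_n$. Such an $M$ is called * *AR-null* if there is $r\ge 0$ such that for all $n\ge 0$ the transition map $M_{n+r}\to M_n$ is zero; * *preadic* if for all $n\ge 0$ the natural map $\Lambda_n\otimes_{\Lambda_{n+1}}M_{n+1}\to M_n$ is an isomorphism; * *adic* if it is preadic and every $M_n$ is a Noetherian object of $\mathrm{Mod}(\mathcal X,\Lambda_n)$; * *AR-adic* if there are an adic module $N$ and a homomorphism $N\to M$ whose kernel and cokernel are AR-null (the $M_n$ themselves need not be Noetherian). Let $\mathcal N$ and $\mathrm{Mod}_{AR\text{-}a}(\mathcal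 X^{\mathbb N},\Lambda_\bullet)$ be the full subcategories of AR-null and of AR-adic modules. **Proposition.** $\mathrm{Mod}_{AR\text{-}a}(\mathcal X^{\mathbb N},\Lambda_\bullet)$ is a thick subcategory of $\mathrm{Mod}(\mathcal X^{\mathbb N},\Lambda_\bullet)$, that is, a nonempty full subcategory, closed under isomorphisms, kernels, cokernels and extensions. Moreover, the quotients $$\mathrm{Mod}_c(\mathcal X,\mathcal O)=\mathrm{Mod}_{AR\text{-}a}(\mathcal X^{\mathbb N},\Lambda_\bullet)/\mathcal N,\qquad D_c(\mathcal X,\mathcal O)=D_{AR\text{-}a}(\mathcal X^{\mathbb N},\Lambda_\bullet)/D_{\mathcal N}$$ are well defined, where $D_{AR\text{-}a}$ (resp. $D_{\mathcal N}$) is the full subcategory of $D(\mathcal X^{\mathbb N},\Lambda_\bullet)$ of complexes all of whose cohomology objects are AR-adic (resp. AR-null), in the following sense: $\mathcal N$ is closed under subobjects, quotients and extensions in $\mathrm{Mod}(\mathcal X^{\mathbb N},\Lambda_\bullet)$ and contained in $\mathrm{Mod}_{AR\text{-}a}(\mathcal X^{\mathbb N},\Lambda_\bullet)$; and $D_{AR\text{-}a}$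 and $D_{\mathcal N}$ are thick triangulated subcategories of $D(\mathcal X^{\mathbb N},\Lambda_\bullet)$ (triangulated and closed under direct summands), with $D_{\mathcal N}\subset D_{AR\text{-}a}$. -/

import Mathlib

open CategoryTheory CategoryTheory.Limits

universe w v u

set_option linter.unusedSectionVars false

noncomputable section

/-! ### Systems along a sequence of functors -/

/-- Given categories `A 0, A 1, …` and functors `R n : A n ⥤ A (n + 1)`, a system consists of
objects `M n` of `A n` and transition morphisms `M (n + 1) ⟶ R n (M n)`. -/
structure ProjSystem (A : ℕ → Type u) [∀ n, Category.{v} (A n)] (R : ∀ n, A n ⥤ A (n + 1)) where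
  obj : ∀ n, A n
  trans : ∀ n, obj (n + 1) ⟶ (R n).obj (obj n)

namespace ProjSystem

section Basic

variable {A : ℕ → Type u} [∀ n, Category.{v} (A n)] {R : ∀ n, A n ⥤ A (n + 1)}

/-- A morphism of systems: a family of morphisms compatible with the transition morphisms. -/
@[ext]
structure Hom (M N : ProjSystem A R) where
  app : ∀ n, M.obj n ⟶ N.obj n
  comm : ∀ n, M.trans n ≫ (R n).map (app n) = app (n + 1) ≫ N.trans n

instance : Category (ProjSystem A R) where
  Hom := Hom
  id M := { app := fun n => 𝟙 _, comm := by simp }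
  comp f g :=
    { app := fun n => f.app n ≫ g.app n
      comm := fun n => by
        rw [Functor.map_comp, reassoc_of% (f.comm n), g.comm, Category.assoc] }

@[ext]
lemma hom_ext {M N : ProjSystem A R} {f g : M ⟶ N} (h : ∀ n, f.app n = g.app n) : f = g :=
  Hom.ext (funext h)

@[simp] lemma id_app (M : ProjSystem A R) (n : ℕ) : Hom.app (𝟙 M) n = 𝟙 (M.obj n) := rfl

@[simp] lemma comp_app {M N P : ProjSystem A R} (f : M ⟶ N) (g : N ⟶ P) (n : ℕ) :
    (f ≫ g).app n = f.app n ≫ g.app n := rfl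

variable (A R) in
/-- The `n`-th component. -/
@[simps]
def ev (n : ℕ) : ProjSystem A R ⥤ A n where
  obj M := M.obj n
  map f := f.app n

lemma comm' {M N : ProjSystem A R} (f : M ⟶ N) (n : ℕ) :
    M.trans n ≫ (R n).map (f.app n) = f.app (n + 1) ≫ N.trans n := f.comm n

lemma isIso_of_app {M N : ProjSystem A R} (f : M ⟶ N) [∀ n, IsIso (f.app n)] : IsIso f := by
  refine ⟨{ app := fun n => inv (f.app n), comm := fun n => ?_ }, ?_, ?_⟩
  · rw [Functor.map_inv, IsIso.comp_inv_eq, Category.assoc, comm', IsIso.inv_hom_id_assoc]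
  · ext n; exact IsIso.hom_inv_id (f.app n)
  · ext n; exact IsIso.inv_hom_id (f.app n)

/-! Colimits and limits of systems are computed componentwise. -/

section Colimits

variable {K : Type} [SmallCategory K] [∀ n, HasColimitsOfShape K (A n)] (F : K ⥤ ProjSystem A R)

/-- The `n`-th component of the colimit. -/
def colimitObj (n : ℕ) : A n := colimit (F ⋙ ev A R n)

/-- The coprojections to the components of the colimit. -/
def colimitι (n : ℕ) (k : K) : (F.obj k).obj n ⟶ colimitObj F n := colimit.ι (F ⋙ ev A R n) k

lemma colimitι_w (n : ℕ) {k l : K} (f : k ⟶ l) :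
    (F.map f).app n ≫ colimitι F n l = colimitι F n k := colimit.w (F ⋙ ev A R n) f

/-- The universal property of the components of the colimit. -/
def colimitDesc (n : ℕ) {X : A n} (g : ∀ k, (F.obj k).obj n ⟶ X)
    (hg : ∀ {k l : K} (f : k ⟶ l), (F.map f).app n ≫ g l = g k) : colimitObj F n ⟶ X :=
  colimit.desc (F ⋙ ev A R n)
    { pt := X, ι := { app := g, naturality := fun _ _ f => (hg f).trans (Category.comp_id _).symm } }

lemma colimitι_desc (n : ℕ) {X : A n} (g : ∀ k, (F.obj k).obj n ⟶ X)
    (hg : ∀ {k l : K} (f : k ⟶ l), (F.map f).app n ≫ g l = g k) (k : K) :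
    colimitι F n k ≫ colimitDesc F n g hg = g k := colimit.ι_desc _ _

lemma colimitObj_hom_ext (n : ℕ) {X : A n} {f g : colimitObj F n ⟶ X}
    (h : ∀ k, colimitι F n k ≫ f = colimitι F n k ≫ g) : f = g := colimit.hom_ext h

lemma colimit_trans_aux (n : ℕ) {k l : K} (f : k ⟶ l) :
    (F.map f).app (n + 1) ≫ (F.obj l).trans n ≫ (R n).map (colimitι F n l) =
      (F.obj k).trans n ≫ (R n).map (colimitι F n k) := by
  rw [← reassoc_of% (comm' (F.map f) n), ← Functor.map_comp, colimitι_w]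

/-- The transition morphisms of the componentwise colimit. -/
def colimitTrans (n : ℕ) : colimitObj F (n + 1) ⟶ (R n).obj (colimitObj F n) :=
  colimitDesc F (n + 1) (fun k => (F.obj k).trans n ≫ (R n).map (colimitι F n k))
    (colimit_trans_aux F n)

/-- The componentwise colimit. -/
def colimitPt : ProjSystem A R where
  obj n := colimitObj F n
  trans n := colimitTrans F n

lemma colimitι_trans (n : ℕ) (k : K) : colimitι F (n + 1) k ≫ colimitTrans F n =
    (F.obj k).trans n ≫ (R n).map (colimitι F n k) :=
  colimitι_desc F (n + 1) (fun k => (F.obj k).trans n ≫ (R n).map (colimitι F n k))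
    (colimit_trans_aux F n) k

/-- The coprojections to the componentwise colimit. -/
def colimitPtι (k : K) : F.obj k ⟶ colimitPt F where
  app n := colimitι F n k
  comm n := (colimitι_trans F n k).symm

lemma colimitPtι_w {k l : K} (f : k ⟶ l) : F.map f ≫ colimitPtι F l = colimitPtι F k :=
  hom_ext fun n => colimitι_w F n f

/-- The componentwise colimit cocone. -/
def colimitCocone : Cocone F where
  pt := colimitPt F
  ι :=
    { app := colimitPtι F
      naturality := fun _ _ f => (colimitPtι_w F f).trans (Category.comp_id _).symm }

lemma cocone_w (s : Cocone F) (n : ℕ) {k l : K} (f : k ⟶ l) :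
    (F.map f).app n ≫ (s.ι.app l).app n = (s.ι.app k).app n :=
  congr_arg (fun g => Hom.app g n) (s.w f)

/-- The universal property of the componentwise colimit. -/
def colimitPtDesc (s : Cocone F) : colimitPt F ⟶ s.pt where
  app n := colimitDesc F n (fun k => (s.ι.app k).app n) (cocone_w F s n)
  comm n := colimitObj_hom_ext F (n + 1) fun k => by
    change _ ≫ colimitTrans F n ≫ (R n).map (X := colimitObj F n) _ =
      _ ≫ CategoryStruct.comp (X := colimitObj F (n + 1)) _ _
    rw [reassoc_of% (colimitι_trans F n k), reassoc_of% (colimitι_desc F (n + 1)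
      (X := s.pt.obj (n + 1)) (fun k => (s.ι.app k).app (n + 1)) (cocone_w F s (n + 1)) k), ← Functor.map_comp, colimitι_desc]
    exact comm' (s.ι.app k) n

/-- The componentwise colimit cocone is a colimit. -/
def colimitCoconeIsColimit : IsColimit (colimitCocone F) where
  desc s := colimitPtDesc F s
  fac s k := hom_ext fun n => colimitι_desc F n (X := s.pt.obj n) (fun k => (s.ι.app k).app n)
    (cocone_w F s n) k
  uniq s m hm := by
    refine hom_ext (f := m) (g := colimitPtDesc F s) fun n => ?_
    refine colimitObj_hom_ext F n (f := m.app n) (g := (colimitPtDesc F s).app n) fun k => ?_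
    exact (congr_arg (fun f => Hom.app f n) (hm k)).trans
      (colimitι_desc F n (X := s.pt.obj n) (fun k => (s.ι.app k).app n)
        (cocone_w F s n) k).symm

instance : HasColimitsOfShape K (ProjSystem A R) where
  has_colimit F := ⟨⟨colimitCocone F, colimitCoconeIsColimit F⟩⟩

instance (n : ℕ) : PreservesColimitsOfShape K (ev A R n) where
  preservesColimit {F} := preservesColimit_of_preserves_colimit_cocone (colimitCoconeIsColimit F)
    (IsColimit.ofIsoColimit (colimit.isColimit (F ⋙ ev A R n))
      (Cocone.ext (Iso.refl (colimitObj F n)) (fun k => Category.comp_id (colimitι F n k))))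

end Colimits

section Limits

variable {K : Type} [SmallCategory K] [∀ n, HasLimitsOfShape K (A n)]
  [∀ n, PreservesLimitsOfShape K (R n)] (F : K ⥤ ProjSystem A R)

/-- The `n`-th component of the limit. -/
def limitObj (n : ℕ) : A n := limit (F ⋙ ev A R n)

/-- The projections from the components of the limit. -/
def limitπ (n : ℕ) (k : K) : limitObj F n ⟶ (F.obj k).obj n := limit.π (F ⋙ ev A R n) k

lemma limitπ_w (n : ℕ) {k l : K} (f : k ⟶ l) :
    limitπ F n k ≫ (F.map f).app n = limitπ F n l := limit.w (F ⋙ ev A R n) f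

/-- The universal property of the components of the limit. -/
def limitLift (n : ℕ) {X : A n} (g : ∀ k, X ⟶ (F.obj k).obj n)
    (hg : ∀ {k l : K} (f : k ⟶ l), g k ≫ (F.map f).app n = g l) : X ⟶ limitObj F n :=
  limit.lift (F ⋙ ev A R n)
    { pt := X, π := { app := g, naturality := fun _ _ f => (Category.id_comp _).trans (hg f).symm } }

lemma limitLift_π (n : ℕ) {X : A n} (g : ∀ k, X ⟶ (F.obj k).obj n)
    (hg : ∀ {k l : K} (f : k ⟶ l), g k ≫ (F.map f).app n = g l) (k : K) :
    limitLift F n g hg ≫ limitπ F n k = g k := limit.lift_π _ _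

lemma limitObj_hom_ext (n : ℕ) {X : A n} {f g : X ⟶ limitObj F n}
    (h : ∀ k, f ≫ limitπ F n k = g ≫ limitπ F n k) : f = g := limit.hom_ext h

/-- The universal property of the images under `R n` of the components of the limit. -/
def limitLift' (n : ℕ) {X : A (n + 1)} (g : ∀ k, X ⟶ (R n).obj ((F.obj k).obj n))
    (hg : ∀ {k l : K} (f : k ⟶ l), g k ≫ (R n).map ((F.map f).app n) = g l) :
    X ⟶ (R n).obj (limitObj F n) :=
  (isLimitOfPreserves (R n) (limit.isLimit (F ⋙ ev A R n))).lift
    { pt := X, π := { app := g, naturality := fun _ _ f => (Category.id_comp _).trans (hg f).symm } }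

lemma limitLift'_π (n : ℕ) {X : A (n + 1)} (g : ∀ k, X ⟶ (R n).obj ((F.obj k).obj n))
    (hg : ∀ {k l : K} (f : k ⟶ l), g k ≫ (R n).map ((F.map f).app n) = g l) (k : K) :
    limitLift' F n g hg ≫ (R n).map (limitπ F n k) = g k :=
  (isLimitOfPreserves (R n) (limit.isLimit (F ⋙ ev A R n))).fac _ k

lemma limitObj_hom_ext' (n : ℕ) {X : A (n + 1)} {f g : X ⟶ (R n).obj (limitObj F n)}
    (h : ∀ k, f ≫ (R n).map (limitπ F n k) = g ≫ (R n).map (limitπ F n k)) : f = g :=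
  (isLimitOfPreserves (R n) (limit.isLimit (F ⋙ ev A R n))).hom_ext h

lemma limit_trans_aux (n : ℕ) {k l : K} (f : k ⟶ l) :
    (limitπ F (n + 1) k ≫ (F.obj k).trans n) ≫ (R n).map ((F.map f).app n) =
      limitπ F (n + 1) l ≫ (F.obj l).trans n := by
  rw [Category.assoc, comm', reassoc_of% (limitπ_w F (n + 1) f)]

/-- The transition morphisms of the componentwise limit. -/
def limitTrans (n : ℕ) : limitObj F (n + 1) ⟶ (R n).obj (limitObj F n) :=
  limitLift' F n (fun k => limitπ F (n + 1) k ≫ (F.obj k).trans n) (limit_trans_aux F n)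

/-- The componentwise limit. -/
def limitPt : ProjSystem A R where
  obj n := limitObj F n
  trans n := limitTrans F n

lemma limit_trans_π (n : ℕ) (k : K) : limitTrans F n ≫ (R n).map (limitπ F n k) =
    limitπ F (n + 1) k ≫ (F.obj k).trans n :=
  limitLift'_π F n (fun k => limitπ F (n + 1) k ≫ (F.obj k).trans n) (limit_trans_aux F n) k

/-- The projections from the componentwise limit. -/
def limitPtπ (k : K) : limitPt F ⟶ F.obj k where
  app n := limitπ F n k
  comm n := limit_trans_π F n k

lemma limitPtπ_w {k l : K} (f : k ⟶ l) : limitPtπ F k ≫ F.map f = limitPtπ F l :=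
  hom_ext fun n => limitπ_w F n f

/-- The componentwise limit cone. -/
def limitCone : Cone F where
  pt := limitPt F
  π :=
    { app := limitPtπ F
      naturality := fun _ _ f => (Category.id_comp _).trans (limitPtπ_w F f).symm }

lemma cone_w (s : Cone F) (n : ℕ) {k l : K} (f : k ⟶ l) :
    (s.π.app k).app n ≫ (F.map f).app n = (s.π.app l).app n :=
  congr_arg (fun g => Hom.app g n) (s.w f)

/-- The universal property of the componentwise limit. -/
def limitPtLift (s : Cone F) : s.pt ⟶ limitPt F where
  app n := limitLift F n (fun k => (s.π.app k).app n) (cone_w F s n)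
  comm n := limitObj_hom_ext' F n fun k => by
    change (_ ≫ (R n).map (Y := limitObj F n) _) ≫ _ = (_ ≫ limitTrans F n) ≫ _
    rw [Category.assoc, Category.assoc, limit_trans_π, reassoc_of% (limitLift_π F (n + 1)
      (X := s.pt.obj (n + 1)) (fun k => (s.π.app k).app (n + 1)) (cone_w F s (n + 1)) k), ← Functor.map_comp,
      limitLift_π]
    exact comm' (s.π.app k) n

/-- The componentwise limit cone is a limit. -/
def limitConeIsLimit : IsLimit (limitCone F) where
  lift s := limitPtLift F s
  fac s k := hom_ext fun n => limitLift_π F n (X := s.pt.obj n) (fun k => (s.π.app k).app n)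
    (cone_w F s n) k
  uniq s m hm := by
    refine hom_ext (f := m) (g := limitPtLift F s) fun n => ?_
    refine limitObj_hom_ext F n (f := m.app n) (g := (limitPtLift F s).app n) fun k => ?_
    exact (congr_arg (fun f => Hom.app f n) (hm k)).trans
      (limitLift_π F n (X := s.pt.obj n) (fun k => (s.π.app k).app n)
        (cone_w F s n) k).symm

instance : HasLimitsOfShape K (ProjSystem A R) where
  has_limit F := ⟨⟨limitCone F, limitConeIsLimit F⟩⟩

instance (n : ℕ) : PreservesLimitsOfShape K (ev A R n) where
  preservesLimit {F} := preservesLimit_of_preserves_limit_cone (limitConeIsLimit F)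
    (IsLimit.ofIsoLimit (limit.isLimit (F ⋙ ev A R n))
      (Cone.ext (Iso.refl (limitObj F n)) (fun k => (Category.id_comp (limitπ F n k)).symm)))

end Limits

end Basic

section Abelian

variable {A : ℕ → Type u} [∀ n, Category.{v} (A n)] {R : ∀ n, A n ⥤ A (n + 1)}

instance [∀ n, Preadditive (A n)] [∀ n, (R n).Additive] : Preadditive (ProjSystem A R) where
  homGroup M N :=
    letI : Zero (M ⟶ N) := ⟨{ app := fun n => 0, comm := by simp }⟩
    letI : Add (M ⟶ N) := ⟨fun f g =>
      { app := fun n => f.app n + g.app n, comm := by simp [Functor.map_add, comm'] }⟩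
    letI : Neg (M ⟶ N) := ⟨fun f =>
      { app := fun n => - f.app n, comm := by simp [Functor.map_neg, comm'] }⟩
    letI : Sub (M ⟶ N) := ⟨fun f g =>
      { app := fun n => f.app n - g.app n, comm := by simp [Functor.map_sub, comm'] }⟩
    letI : SMul ℕ (M ⟶ N) := ⟨fun k f =>
      { app := fun n => k • f.app n, comm := by simp [comm'] }⟩
    letI : SMul ℤ (M ⟶ N) := ⟨fun k f =>
      { app := fun n => k • f.app n, comm := by simp [comm'] }⟩
    Function.Injective.addCommGroup (fun (f : M ⟶ N) n => f.app n)
      (fun _ _ h => hom_ext (congr_fun h)) rfl (fun _ _ => rfl) (fun _ => rfl) (fun _ _ => rfl)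
      (fun _ _ => rfl) (fun _ _ => rfl)
  add_comp _ _ _ f f' g := hom_ext fun n => Preadditive.add_comp _ _ _ (f.app n) (f'.app n) (g.app n)
  comp_add _ _ _ f g g' := hom_ext fun n => Preadditive.comp_add _ _ _ (f.app n) (g.app n) (g'.app n)

instance [∀ n, Preadditive (A n)] [∀ n, (R n).Additive] (n : ℕ) : (ev A R n).Additive where
  map_add := rfl

variable [∀ n, Abelian (A n)] [∀ n, (R n).Additive] [∀ n, PreservesFiniteLimits (R n)]

instance : HasFiniteColimits (ProjSystem A R) := ⟨fun _ _ _ => inferInstance⟩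

instance : HasFiniteLimits (ProjSystem A R) := ⟨fun _ _ _ => inferInstance⟩

instance (n : ℕ) : PreservesFiniteColimits (ev A R n) := ⟨fun _ _ _ => inferInstance⟩

instance (n : ℕ) : PreservesFiniteLimits (ev A R n) := ⟨fun _ _ _ => inferInstance⟩

instance {M N : ProjSystem A R} (f : M ⟶ N) : IsIso (Abelian.coimageImageComparison f) := by
  have (n : ℕ) : IsIso ((Abelian.coimageImageComparison f).app n) := by
    have : IsIso ((ev A R n).map (Abelian.coimageImageComparison f)) := by
      rw [Arrow.isIso_iff_isIso_of_isIso (Abelian.PreservesCoimageImageComparison.iso (ev A R n) f).hom]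
      infer_instance
    exact this
  exact isIso_of_app _

instance : Abelian (ProjSystem A R) := Abelian.ofCoimageImageComparisonIsIso

end Abelian

end ProjSystem

/-! ### Modules over `Λ_•` on the topos of projective systems -/

section Modules

variable (O : Type u) [CommRing O] [IsLocalRing O]

/-- The ring `Λ_n = O / 𝔪 ^ (n + 1)`. -/
abbrev LambdaRing (n : ℕ) : Type u := O ⧸ IsLocalRing.maximalIdeal O ^ (n + 1)

/-- The transition map `Λ_{n + 1} → Λ_n`, induced by the identity of `O`. -/
def lambdaTrans (n : ℕ) : LambdaRing O (n + 1) →+* LambdaRing O n :=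
  Ideal.Quotient.factor (Ideal.pow_le_pow_right (Nat.le_succ (n + 1)))

variable {C : Type u} [SmallCategory C] (J : GrothendieckTopology C)

/-- The category of sheaves of `Λ_n`-modules on the topos of sheaves on `(C, J)`. -/
abbrev LambdaSheaf (n : ℕ) := Sheaf J (ModuleCat.{u} (LambdaRing O n))

/-- Restriction of scalars along `Λ_{n + 1} → Λ_n`. -/
abbrev lambdaRestrict (n : ℕ) : LambdaSheaf O J n ⥤ LambdaSheaf O J (n + 1) :=
  sheafCompose J (ModuleCat.restrictScalars (lambdaTrans O n))

/-- Extension of scalars `Λ_n ⊗_{Λ_{n + 1}} -`: the sheafification of the sectionwise tensor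
product. -/
abbrev lambdaExtend (n : ℕ) : LambdaSheaf O J (n + 1) ⥤ LambdaSheaf O J n :=
  Sheaf.composeAndSheafify J (ModuleCat.extendScalars (lambdaTrans O n))

/-- Extension of scalars is left adjoint to restriction of scalars. -/
abbrev lambdaAdj (n : ℕ) : lambdaExtend O J n ⊣ lambdaRestrict O J n :=
  Sheaf.adjunction J (ModuleCat.extendRestrictScalarsAdj (lambdaTrans O n))

instance (n : ℕ) : (lambdaRestrict O J n).Additive where
  map_add := rfl

instance (n : ℕ) : PreservesFiniteLimits (lambdaRestrict O J n) :=
  have := (lambdaAdj O J n).rightAdjoint_preservesLimits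
  inferInstance

/-- The category of modules over the ring `Λ_• = (Λ_n)` in the topos of projective systems of
sheaves on `(C, J)`: a module is a projective system `(M_n)`, where `M_n` is a sheaf of
`Λ_n`-modules and the transition maps `M_{n + 1} ⟶ M_n` are `Λ_{n + 1}`-linear. -/
abbrev LambdaMod := ProjSystem (LambdaSheaf O J) (lambdaRestrict O J)

namespace LambdaMod

/-- A sheaf of `Λ_n`-modules viewed as a sheaf of `O`-modules. -/
abbrev toO (n : ℕ) : LambdaSheaf O J n ⥤ Sheaf J (ModuleCat.{u} O) :=
  sheafCompose J (ModuleCat.restrictScalars (Ideal.Quotient.mk _))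

variable {O J}

/-- The transition morphism `M_{n + 1} ⟶ M_n`, as an `O`-linear morphism of sheaves. -/
def step (M : LambdaMod O J) (n : ℕ) :
    (toO O J (n + 1)).obj (M.obj (n + 1)) ⟶ (toO O J n).obj (M.obj n) :=
  (toO O J (n + 1)).map (M.trans n) ≫
    ⟨Functor.whiskerLeft (M.obj n).obj (ModuleCat.restrictScalarsComp'
      (Ideal.Quotient.mk _) (lambdaTrans O n) (Ideal.Quotient.mk _) rfl).inv⟩

/-- The transition morphism `M_{n + r} ⟶ M_n`, as an `O`-linear morphism of sheaves. -/
def transition (M : LambdaMod O J) (n : ℕ) :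
    ∀ r : ℕ, (toO O J (n + r)).obj (M.obj (n + r)) ⟶ (toO O J n).obj (M.obj n)
  | 0 => 𝟙 _
  | r + 1 => M.step (n + r) ≫ M.transition n r

variable (O J)

/-- `M` is AR-null if there is an `r`, independent of `n`, such that all the transition morphisms
`M_{n + r} ⟶ M_n` are zero. -/
def isARNull : ObjectProperty (LambdaMod O J) :=
  fun M => ∃ r : ℕ, ∀ n : ℕ, M.transition n r = 0

/-- `M` is preadic if all the natural morphisms `Λ_n ⊗_{Λ_{n + 1}} M_{n + 1} ⟶ M_n` are
isomorphisms. -/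
def isPreadic : ObjectProperty (LambdaMod O J) :=
  fun M => ∀ n : ℕ, IsIso (((lambdaAdj O J n).homEquiv (M.obj (n + 1)) (M.obj n)).symm (M.trans n))

/-- `M` is adic if it is preadic and all the `M_n` are Noetherian sheaves of `Λ_n`-modules. -/
def isAdic : ObjectProperty (LambdaMod O J) :=
  fun M => isPreadic O J M ∧ ∀ n : ℕ, IsNoetherianObject (M.obj n)

/-- `M` is AR-adic if there is a morphism `N ⟶ M` with `N` adic, whose kernel and cokernel are
AR-null. -/
def isARAdic : ObjectProperty (LambdaMod O J) :=
  fun M => ∃ (N : LambdaMod O J) (f : N ⟶ M),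
    isAdic O J N ∧ isARNull O J (kernel f) ∧ isARNull O J (cokernel f)

end LambdaMod

end Modules

/-! ### Thick subcategories -/

/-- A thick subcategory of an abelian category: a (strictly full, nonempty) full subcategory closed
under kernels, cokernels and extensions. -/
class IsThickSubcategory {A : Type u} [Category.{v} A] [Abelian A] (P : ObjectProperty A) : Prop
    extends P.ContainsZero, P.IsClosedUnderIsomorphisms, P.IsClosedUnderKernels,
      P.IsClosedUnderCokernels, P.IsClosedUnderExtensions

/-- A thick triangulated subcategory: a triangulated subcategory closed under direct summands. -/
class IsThickTriangulated {T : Type u} [Category.{v} T] [HasZeroObject T] [HasShift T ℤ]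
    [Preadditive T] [∀ n : ℤ, (shiftFunctor T n).Additive] [Pretriangulated T]
    (P : ObjectProperty T) : Prop
    extends P.IsTriangulated, P.IsStableUnderRetracts

/-- The complexes all of whose cohomology objects satisfy `P`. -/
def cohomologyIn {A : Type u} [Category.{v} A] [Abelian A] [HasDerivedCategory.{w} A]
    (P : ObjectProperty A) : ObjectProperty (DerivedCategory A) :=
  fun M => ∀ i : ℤ, P ((DerivedCategory.homologyFunctor A i).obj M)

end

/-! ### Noetherian objects form a Serre class -/

section Noetherian

variable {A : Type u} [Category.{v} A] [Abelian A]

lemma CategoryTheory.Subobject.factors_iff_comp_cokernel_eq_zero {X T : A} (U : Subobject X)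
    (x : T ⟶ X) : U.Factors x ↔ x ≫ cokernel.π U.arrow = 0 := by
  refine ⟨fun h => ?_, fun h => ?_⟩
  · rw [← U.factorThru_arrow x h, Category.assoc, cokernel.condition, comp_zero]
  · rw [← Abelian.monoLift_comp U.arrow x h]
    exact Subobject.factors_comp_arrow _

lemma CategoryTheory.Subobject.factors_of_epi {X T T' : A} (U : Subobject X) (p : T' ⟶ T) [Epi p]
    {x : T ⟶ X} (h : U.Factors (p ≫ x)) : U.Factors x := by
  rw [Subobject.factors_iff_comp_cokernel_eq_zero] at h ⊢
  rwa [← cancel_epi p, comp_zero, ← Category.assoc]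

lemma CategoryTheory.Limits.imageSubobject_factors_iff {X Y T : A} (f : X ⟶ Y) (y : T ⟶ Y) :
    (imageSubobject f).Factors y ↔
      ∃ (T' : A) (p : T' ⟶ T) (_ : Epi p) (x : T' ⟶ X), p ≫ y = x ≫ f := by
  constructor
  · intro h
    obtain ⟨T', p, hp, x, hx⟩ := surjective_up_to_refinements_of_epi
      (factorThruImageSubobject f) ((imageSubobject f).factorThru y h)
    refine ⟨T', p, hp, x, ?_⟩
    have := congr($hx ≫ (imageSubobject f).arrow)
    simpa using this
  · rintro ⟨T', p, hp, x, hx⟩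
    refine (imageSubobject f).factors_of_epi p ?_
    rw [hx]
    exact imageSubobject_factors_comp_self f x

instance isNoetherianObject_isClosedUnderQuotients :
    (isNoetherianObject (C := A)).IsClosedUnderQuotients where
  prop_of_epi {X Y} p _ hX := by
    have : WellFoundedGT (Subobject X) := hX
    have key (U V : Subobject Y) (h : (Subobject.pullback p).obj U ≤
        (Subobject.pullback p).obj V) : U ≤ V := by
      refine Subobject.le_of_factors ?_
      obtain ⟨T, q, hq, x, hx⟩ := surjective_up_to_refinements_of_epi p U.arrow
      refine V.factors_of_epi q ?_
      rw [hx, ← pullback_factors_iff]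
      refine Subobject.factors_of_le _ h ?_
      rw [pullback_factors_iff, ← hx]
      exact Subobject.factors_comp_arrow q
    exact ((Subobject.pullback p).monotone.strictMono_of_injective fun U V h =>
      le_antisymm (key U V h.le) (key V U h.ge)).wellFoundedGT

instance isNoetherianObject_isClosedUnderExtensions :
    (isNoetherianObject (C := A)).IsClosedUnderExtensions where
  prop_X₂_of_shortExact {S} hS h₁ h₃ := by
    have : WellFoundedGT (Subobject S.X₁) := h₁
    have : WellFoundedGT (Subobject S.X₃) := h₃
    have := hS.mono_f
    have := hS.epi_g
    let φ : Subobject S.X₂ → Subobject S.X₁ × Subobject S.X₃ := fun U =>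
      ((Subobject.pullback S.f).obj U, imageSubobject (U.arrow ≫ S.g))
    have hφ : Monotone φ := fun U V h =>
      ⟨(Subobject.pullback S.f).monotone h, by
        have := imageSubobject_comp_le (Subobject.ofLE U V h) (V.arrow ≫ S.g)
        simpa using this⟩
    have key (U V : Subobject S.X₂) (hUV : U ≤ V) (h : φ V ≤ φ U) : V ≤ U := by
      refine Subobject.le_of_factors ?_
      have hV : (imageSubobject (U.arrow ≫ S.g)).Factors (V.arrow ≫ S.g) := by
        refine Subobject.factors_of_le _ h.2 ?_
        exact (imageSubobject_factors_iff _ _).2 ⟨_, 𝟙 _, inferInstance, 𝟙 _, rfl⟩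
      rw [imageSubobject_factors_iff] at hV
      obtain ⟨T, p, hp, x, hx⟩ := hV
      obtain ⟨T', q, hq, a, ha⟩ := hS.exact.exact_up_to_refinements
        (p ≫ V.arrow - x ≫ U.arrow) (by simp [hx])
      have haV : V.Factors (a ≫ S.f) := by
        rw [← ha]
        have := Subobject.factors_comp_arrow (P := V) (q ≫ (p - x ≫ Subobject.ofLE U V hUV))
        simpa using this
      have haU : U.Factors (a ≫ S.f) := by
        rw [← pullback_factors_iff] at haV ⊢
        exact Subobject.factors_of_le _ h.1 haV
      refine U.factors_of_epi p (U.factors_of_epi q ?_)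
      have : q ≫ p ≫ V.arrow = a ≫ S.f + (q ≫ x) ≫ U.arrow := by
        rw [← ha]; simp
      rw [this]
      exact Subobject.factors_add _ _ haU (Subobject.factors_comp_arrow _)
    have hφ' : StrictMono φ := fun U V h =>
      lt_of_le_not_ge (hφ h.le) fun h' => h.not_ge (key U V h.le h')
    exact hφ'.wellFoundedGT

instance : (isNoetherianObject (C := A)).IsSerreClass where

end Noetherian

/-! ### Inverse systems in an abelian category -/

namespace InvSystem

open Opposite ZeroObject

variable {A : Type u} [Category.{v} A]

/-- The transition morphism `M_n ⟶ M_m` of an inverse system, for `m ≤ n`. -/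
def tr (M : ℕᵒᵖ ⥤ A) {m n : ℕ} (h : m ≤ n) : M.obj (op n) ⟶ M.obj (op m) :=
  M.map (homOfLE h).op

@[simp]
lemma tr_self (M : ℕᵒᵖ ⥤ A) (n : ℕ) : tr M (le_refl n) = 𝟙 _ := M.map_id _

@[simp]
lemma tr_tr (M : ℕᵒᵖ ⥤ A) {k m n : ℕ} (h : k ≤ m) (h' : m ≤ n) :
    tr M h' ≫ tr M h = tr M (h.trans h') := by
  rw [tr, tr, ← M.map_comp]; rfl

@[simp]
lemma tr_tr_assoc (M : ℕᵒᵖ ⥤ A) {k m n : ℕ} (h : k ≤ m) (h' : m ≤ n) {Z : A}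
    (f : M.obj (op k) ⟶ Z) : tr M h' ≫ tr M h ≫ f = tr M (h.trans h') ≫ f := by
  rw [← Category.assoc, tr_tr]

lemma app_tr {M N : ℕᵒᵖ ⥤ A} (f : M ⟶ N) {m n : ℕ} (h : m ≤ n) :
    f.app (op n) ≫ tr N h = tr M h ≫ f.app (op m) := (f.naturality _).symm

/-- A morphism of inverse systems, from a family compatible with the transition morphisms. -/
def mkHom {M N : ℕᵒᵖ ⥤ A} (f : ∀ n : ℕ, M.obj (op n) ⟶ N.obj (op n))
    (hf : ∀ {m n : ℕ} (h : m ≤ n), f n ≫ tr N h = tr M h ≫ f m) : M ⟶ N where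
  app n := f n.unop
  naturality _ _ g := (hf (leOfHom g.unop)).symm

lemma epi_tr {M : ℕᵒᵖ ⥤ A} (hM : ∀ n : ℕ, Epi (tr M n.le_succ)) {m n : ℕ} (h : m ≤ n) :
    Epi (tr M h) := by
  induction n, h using Nat.le_induction with
  | base => rw [tr_self]; infer_instance
  | succ n h ih =>
    have := hM n
    rw [← tr_tr M h n.le_succ]
    exact epi_comp _ _

variable [Abelian A]

lemma exact_app {S : ShortComplex (ℕᵒᵖ ⥤ A)} (hS : S.Exact) (n : ℕ) {T : A}
    (x : T ⟶ S.X₂.obj (op n)) (hx : x ≫ S.g.app (op n) = 0) :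
    ∃ (T' : A) (p : T' ⟶ T) (_ : Epi p) (y : T' ⟶ S.X₁.obj (op n)),
      p ≫ x = y ≫ S.f.app (op n) :=
  (hS.map ((evaluation ℕᵒᵖ A).obj (op n))).exact_up_to_refinements x hx

lemma exact_kernel {M N : ℕᵒᵖ ⥤ A} (f : M ⟶ N) (n : ℕ) {T : A}
    (x : T ⟶ M.obj (op n)) (hx : x ≫ f.app (op n) = 0) :
    ∃ (T' : A) (p : T' ⟶ T) (_ : Epi p) (y : T' ⟶ (kernel f).obj (op n)),
      p ≫ x = y ≫ (kernel.ι f).app (op n) :=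
  exact_app (ShortComplex.exact_kernel f) n x hx

lemma kernel_ι_app {M N : ℕᵒᵖ ⥤ A} (f : M ⟶ N) (n : ℕ) :
    (kernel.ι f).app (op n) ≫ f.app (op n) = 0 := by
  rw [← NatTrans.comp_app, kernel.condition]; rfl

/-! #### Null systems -/

variable (A) in
/-- Systems for which there is an `r` such that all the transition morphisms `M_{n + r} ⟶ M_n`
vanish. -/
def isNull : ObjectProperty (ℕᵒᵖ ⥤ A) :=
  fun M => ∃ r : ℕ, ∀ n : ℕ, tr M (n.le_add_right r) = 0

instance : (isNull A).ContainsZero where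
  exists_zero :=
    have h : IsZero (0 : ℕᵒᵖ ⥤ A) := isZero_zero _
    ⟨_, h, 0, fun _ => (h.obj _).eq_of_src _ _⟩

instance : (isNull A).IsClosedUnderSubobjects where
  prop_of_mono {M N} f _ := fun ⟨r, hr⟩ => ⟨r, fun n => by
    rw [← cancel_mono (f.app (op n)), ← app_tr, hr, comp_zero, zero_comp]⟩

instance : (isNull A).IsClosedUnderQuotients where
  prop_of_epi {M N} f _ := fun ⟨r, hr⟩ => ⟨r, fun n => by
    rw [← cancel_epi (f.app (op (n + r))), app_tr, hr, comp_zero, zero_comp]⟩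

instance : (isNull A).IsClosedUnderExtensions where
  prop_X₂_of_shortExact {S} hS := fun ⟨r, hr⟩ ⟨s, hs⟩ => by
    refine ⟨r + s, fun n => ?_⟩
    obtain ⟨T, p, _, y, hy⟩ := exact_app hS.exact (n + r)
      (tr S.X₂ (show n + r ≤ n + (r + s) by lia)) (by
        have : tr S.X₂ (show n + r ≤ n + (r + s) by lia) =
          tr S.X₂ (show n + r + s ≤ n + (r + s) by lia) ≫ tr S.X₂ (Nat.le_add_right _ s) := by simp
        rw [this, Category.assoc, ← app_tr, hs, comp_zero, comp_zero])
    rw [← tr_tr S.X₂ (n.le_add_right r) (by lia), ← cancel_epi p, reassoc_of% hy, app_tr, hr,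
      zero_comp, comp_zero, comp_zero]

instance : (isNull A).IsSerreClass where

lemma eq_zero_of_isNull {M N : ℕᵒᵖ ⥤ A} (hM : ∀ n : ℕ, Epi (tr M n.le_succ)) (hN : isNull A N)
    (f : M ⟶ N) : f = 0 := by
  obtain ⟨r, hr⟩ := hN
  ext ⟨n⟩
  have := epi_tr hM (n.le_add_right r)
  rw [← cancel_epi (tr M (n.le_add_right r)), ← app_tr, hr]
  simp

/-! #### Bounded and preadic systems -/

variable {R : Type w} [CommRing R] [Linear R A] (c : R)

variable (A) in
/-- Systems such that `M_n` is killed by `c ^ (n + 1)`. -/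
def isBounded : ObjectProperty (ℕᵒᵖ ⥤ A) :=
  fun M => ∀ n : ℕ, c ^ (n + 1) • 𝟙 (M.obj (op n)) = 0

variable {c}

lemma isBounded.smul_eq_zero {M : ℕᵒᵖ ⥤ A} (hM : isBounded A c M) {n k : ℕ} (h : n < k) {T : A}
    (x : T ⟶ M.obj (op n)) : c ^ k • x = 0 := by
  obtain ⟨l, rfl⟩ := Nat.exists_eq_add_of_le' h
  rw [pow_add, mul_smul, ← Category.comp_id x, ← Linear.comp_smul, hM, comp_zero, smul_zero]

variable (c)

instance : (isBounded A c).IsClosedUnderSubobjects where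
  prop_of_mono {M N} f _ hN n := by
    rw [← cancel_mono (f.app (op n)), Linear.smul_comp, hN.smul_eq_zero n.lt_succ_self, zero_comp]

instance : (isBounded A c).IsClosedUnderQuotients where
  prop_of_epi {M N} f _ hM n := by
    rw [← cancel_epi (f.app (op n)), Linear.comp_smul, Category.comp_id, comp_zero,
      ← Category.id_comp (f.app (op n)), ← Linear.smul_comp, hM, zero_comp]

/-- The kernels of the transition morphisms `M_{n + r + 1} ⟶ M_{n + r}` consist of multiples
of `c ^ (n + 1)`. -/
def KernelBound (r : ℕ) (M : ℕᵒᵖ ⥤ A) : Prop :=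
  ∀ (n : ℕ) {T : A} (x : T ⟶ M.obj (op (n + r + 1))), x ≫ tr M (n + r).le_succ = 0 →
    ∃ (T' : A) (p : T' ⟶ T) (_ : Epi p) (y : T' ⟶ M.obj (op (n + r + 1))),
      p ≫ x = c ^ (n + 1) • y

variable {c}

lemma KernelBound.of_le {r : ℕ} {M : ℕᵒᵖ ⥤ A} (hr : KernelBound c r M)
    (hM : ∀ n : ℕ, Epi (tr M n.le_succ)) {n m : ℕ} (h : n + r ≤ m) {T : A}
    (x : T ⟶ M.obj (op m)) (hx : x ≫ tr M h = 0) :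
    ∃ (T' : A) (p : T' ⟶ T) (_ : Epi p) (y : T' ⟶ M.obj (op m)), p ≫ x = c ^ (n + 1) • y := by
  induction m, h using Nat.le_induction generalizing T with
  | base =>
    rw [tr_self, Category.comp_id] at hx
    exact ⟨T, 𝟙 T, inferInstance, 0, by simp [hx]⟩
  | succ m h ih =>
    obtain ⟨T₁, p₁, _, y₁, hy₁⟩ := ih (x ≫ tr M m.le_succ) (by simpa using hx)
    have := hM m
    obtain ⟨T₂, p₂, _, y₂, hy₂⟩ := surjective_up_to_refinements_of_epi (tr M m.le_succ) y₁
    obtain ⟨k, rfl⟩ := Nat.exists_eq_add_of_le' (le_of_add_le_right h)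
    obtain ⟨T₃, p₃, _, y₃, hy₃⟩ := hr k (p₂ ≫ p₁ ≫ x - c ^ (n + 1) • y₂) (by
      simp [Preadditive.sub_comp, Linear.smul_comp, ← hy₂, hy₁])
    obtain ⟨l, rfl⟩ := Nat.exists_eq_add_of_le' (show n ≤ k by lia)
    refine ⟨T₃, p₃ ≫ p₂ ≫ p₁, inferInstance, p₃ ≫ y₂ + c ^ l • y₃, ?_⟩
    rw [Preadditive.comp_sub, sub_eq_iff_eq_add] at hy₃
    simp only [Category.assoc, hy₃, smul_add, smul_smul, Linear.comp_smul]
    rw [show c ^ (l + n + 1) = c ^ (n + 1) * c ^ l by ring]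
    exact add_comm _ _

variable (A c) in
/-- Systems such that `M_n` is the quotient of `M_{n + 1}` by `c ^ (n + 1)`. -/
structure isPreadic (M : ℕᵒᵖ ⥤ A) : Prop where
  bounded : isBounded A c M
  epi : ∀ n : ℕ, Epi (tr M n.le_succ)
  kernelBound : KernelBound c 0 M

lemma isPreadic.exists_smul {P : ℕᵒᵖ ⥤ A} (hP : isPreadic A c P) {n m : ℕ} (h : n ≤ m) {T : A}
    (x : T ⟶ P.obj (op m)) (hx : x ≫ tr P h = 0) :
    ∃ (T' : A) (p : T' ⟶ T) (_ : Epi p) (y : T' ⟶ P.obj (op m)), p ≫ x = c ^ (n + 1) • y :=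
  hP.kernelBound.of_le hP.epi h x hx

lemma isPreadic.exists_lift_of_epi {P X Y : ℕᵒᵖ ⥤ A} (hP : isPreadic A c P)
    (hX : isBounded A c X) (u : X ⟶ Y) [Epi u] (hu : isNull A (kernel u)) (g : P ⟶ Y) :
    ∃ h : P ⟶ X, h ≫ u = g := by
  obtain ⟨r, hr⟩ := hu
  have hd (n : ℕ) : kernel.ι (u.app (op (n + r))) ≫ tr X (n.le_add_right r) = 0 := by
    obtain ⟨T, p, _, y, hy⟩ := exact_kernel u (n + r) (kernel.ι (u.app (op (n + r))))
      (kernel.condition _)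
    rw [← cancel_epi p, reassoc_of% hy, app_tr, hr, zero_comp, comp_zero, comp_zero]
  let d (n : ℕ) : Y.obj (op (n + r)) ⟶ X.obj (op n) := Abelian.epiDesc (u.app (op (n + r))) _ (hd n)
  have ud (n : ℕ) : u.app (op (n + r)) ≫ d n = tr X (n.le_add_right r) := Abelian.comp_epiDesc _ _ _
  have du (n : ℕ) : d n ≫ u.app (op n) = tr Y (n.le_add_right r) := by
    rw [← cancel_epi (u.app (op (n + r))), reassoc_of% (ud n), app_tr]
  have dtr {m n : ℕ} (h : m ≤ n) :
      tr Y (Nat.add_le_add_right h r) ≫ d m = d n ≫ tr X h := by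
    rw [← cancel_epi (u.app (op (n + r))), reassoc_of% (ud n), reassoc_of% (app_tr u), ud]
    simp
  have htr (n : ℕ) : Epi (tr P (n.le_add_right r)) := epi_tr hP.epi _
  have hk (n : ℕ) : kernel.ι (tr P (n.le_add_right r)) ≫ g.app (op (n + r)) ≫ d n = 0 := by
    obtain ⟨T, p, _, y, hy⟩ := hP.exists_smul (n.le_add_right r) _ (kernel.condition _)
    rw [← cancel_epi p, reassoc_of% hy, Linear.smul_comp, hX.smul_eq_zero n.lt_succ_self,
      comp_zero]
  let h (n : ℕ) : P.obj (op n) ⟶ X.obj (op n) := Abelian.epiDesc (tr P (n.le_add_right r)) _ (hk n)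
  have trh (n : ℕ) : tr P (n.le_add_right r) ≫ h n = g.app (op (n + r)) ≫ d n :=
    Abelian.comp_epiDesc _ _ _
  refine ⟨mkHom h fun {m n} hmn => ?_, ?_⟩
  · rw [← cancel_epi (tr P (n.le_add_right r)), reassoc_of% (trh n), ← dtr, reassoc_of% (app_tr g),
      ← trh]
    simp
  · ext ⟨n⟩
    rw [← cancel_epi (tr P (n.le_add_right r)), NatTrans.comp_app]
    change _ ≫ h n ≫ _ = _
    rw [reassoc_of% (trh n), du, app_tr]

lemma isPreadic.exists_lift {P X Y : ℕᵒᵖ ⥤ A} (hP : isPreadic A c P)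
    (hX : isBounded A c X) (u : X ⟶ Y) (hu : (isNull A).isoModSerre u) (g : P ⟶ Y) :
    ∃ h : P ⟶ X, h ≫ u = g := by
  have hg : g ≫ cokernel.π (Abelian.image.ι u) = 0 :=
    eq_zero_of_isNull hP.epi hu.2.isoModSerre_image_ι.2 _
  obtain ⟨h, hh⟩ := hP.exists_lift_of_epi hX (Abelian.factorThruImage u)
    hu.1.isoModSerre_factorThruImage.1 (Abelian.monoLift (Abelian.image.ι u) g hg)
  exact ⟨h, by rw [← Abelian.image.fac u, reassoc_of% hh, Abelian.monoLift_comp]⟩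

end InvSystem

namespace InvSystem

open Opposite ZeroObject

variable {A : Type u} [Category.{v} A] [Abelian A] {R : Type w} [CommRing R] [Linear R A] {c : R}

/-! #### Adic and AR-adic systems -/

variable (A c) in
/-- Preadic systems whose components are Noetherian. -/
structure isAdic (M : ℕᵒᵖ ⥤ A) : Prop extends isPreadic A c M where
  noetherian : ∀ n : ℕ, isNoetherianObject (M.obj (op n))

variable (A c) in
/-- Systems which are targets of a morphism with null kernel and cokernel from an adic system. -/
def isARAdic : ObjectProperty (ℕᵒᵖ ⥤ A) :=
  fun M => ∃ (N : ℕᵒᵖ ⥤ A) (f : N ⟶ M), isAdic A c N ∧ (isNull A).isoModSerre f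

lemma isARAdic.of_isoModSerre {X Y : ℕᵒᵖ ⥤ A} (u : X ⟶ Y) (hu : (isNull A).isoModSerre u)
    (hX : isARAdic A c X) : isARAdic A c Y := by
  obtain ⟨N, f, hN, hf⟩ := hX
  exact ⟨N, f ≫ u, hN, MorphismProperty.comp_mem _ _ _ hf hu⟩

instance : (isARAdic A c).IsClosedUnderIsomorphisms where
  of_iso e h := h.of_isoModSerre e.hom ((isNull A).isoModSerre_of_isIso _)

variable (A c) in
/-- Bounded systems with Noetherian components and epimorphic transition morphisms such that the
kernel of `M_{n + r + 1} ⟶ M_{n + r}` consists of multiples of `c ^ (n + 1)`, for some `r`. -/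
structure isStrict (M : ℕᵒᵖ ⥤ A) : Prop where
  bounded : isBounded A c M
  epi : ∀ n : ℕ, Epi (tr M n.le_succ)
  noetherian : ∀ n : ℕ, isNoetherianObject (M.obj (op n))
  exists_kernelBound : ∃ r : ℕ, KernelBound c r M

lemma isAdic.isStrict {M : ℕᵒᵖ ⥤ A} (hM : isAdic A c M) : isStrict A c M where
  bounded := hM.bounded
  epi := hM.epi
  noetherian := hM.noetherian
  exists_kernelBound := ⟨0, hM.kernelBound⟩

variable (c) in
/-- The system `M_{n + r} / c ^ (n + 1)`. -/
noncomputable def quotShift (M : ℕᵒᵖ ⥤ A) (r : ℕ) : ℕᵒᵖ ⥤ A where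
  obj k := cokernel (c ^ (k.unop + 1) • 𝟙 (M.obj (op (k.unop + r))))
  map {k l} f := cokernel.desc _ (tr M (Nat.add_le_add_right (leOfHom f.unop) r) ≫ cokernel.π _) (by
    obtain ⟨d, hd⟩ := Nat.exists_eq_add_of_le' (leOfHom f.unop)
    have : c ^ (k.unop + 1) = c ^ d * c ^ (l.unop + 1) := by rw [hd]; ring
    have h := cokernel.condition (c ^ (l.unop + 1) • 𝟙 (M.obj (op (l.unop + r))))
    rw [Linear.smul_comp, Category.id_comp] at h
    rw [Linear.smul_comp, Category.id_comp, this, mul_smul, ← Linear.comp_smul, h, comp_zero,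
      smul_zero])
  map_id k := by
    rw [← cancel_epi (cokernel.π _), cokernel.π_desc]
    simp
  map_comp {k l m} f g := by
    rw [← cancel_epi (cokernel.π _), cokernel.π_desc, cokernel.π_desc_assoc, Category.assoc,
      cokernel.π_desc]
    simp

/-- The projection `M_{n + r} ⟶ M_{n + r} / c ^ (n + 1)`. -/
noncomputable def quotShiftπ (c : R) (M : ℕᵒᵖ ⥤ A) (r n : ℕ) :
    M.obj (op (n + r)) ⟶ (quotShift c M r).obj (op n) :=
  cokernel.π (c ^ (n + 1) • 𝟙 (M.obj (op (n + r))))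

instance (M : ℕᵒᵖ ⥤ A) (r n : ℕ) : Epi (quotShiftπ c M r n) :=
  inferInstanceAs (Epi (cokernel.π (c ^ (n + 1) • 𝟙 (M.obj (op (n + r))))))

lemma smul_quotShiftπ (M : ℕᵒᵖ ⥤ A) (r n : ℕ) : c ^ (n + 1) • quotShiftπ c M r n = 0 := by
  have h := cokernel.condition (c ^ (n + 1) • 𝟙 (M.obj (op (n + r))))
  rwa [Linear.smul_comp, Category.id_comp] at h

lemma quotShiftπ_tr (M : ℕᵒᵖ ⥤ A) (r : ℕ) {m n : ℕ} (h : m ≤ n) :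
    quotShiftπ c M r n ≫ tr (quotShift c M r) h =
      tr M (Nat.add_le_add_right h r) ≫ quotShiftπ c M r m :=
  cokernel.π_desc _ _ _

lemma exists_eq_smul_of_comp_quotShiftπ (M : ℕᵒᵖ ⥤ A) (r n : ℕ) {T : A}
    (x : T ⟶ M.obj (op (n + r))) (hx : x ≫ quotShiftπ c M r n = 0) :
    ∃ (T' : A) (p : T' ⟶ T) (_ : Epi p) (y : T' ⟶ M.obj (op (n + r))),
      p ≫ x = c ^ (n + 1) • y := by
  obtain ⟨T', p, hp, y, hy⟩ :=
    (CokernelCofork.IsColimit.comp_π_eq_zero_iff_up_to_refinements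
      (cokernelIsCokernel (c ^ (n + 1) • 𝟙 (M.obj (op (n + r))))) x).1 hx
  exact ⟨T', p, hp, y, by rw [hy, Linear.comp_smul, Category.comp_id]⟩

lemma isStrict.isAdic_quotShift {M : ℕᵒᵖ ⥤ A} (hM : isStrict A c M) {r : ℕ}
    (hr : KernelBound c r M) : isAdic A c (quotShift c M r) where
  bounded n := by
    rw [← cancel_epi (quotShiftπ c M r n), Linear.comp_smul, Category.comp_id, smul_quotShiftπ,
      comp_zero]
  epi n := by
    have := epi_tr hM.epi (Nat.add_le_add_right n.le_succ r)
    exact epi_of_epi_fac (f := quotShiftπ c M r (n + 1))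
      (quotShiftπ_tr (c := c) M r n.le_succ)
  noetherian n := isNoetherianObject.prop_of_epi (quotShiftπ c M r n) (hM.noetherian _)
  kernelBound n T x hx := by
    obtain ⟨T₁, p₁, _, e, he⟩ := surjective_up_to_refinements_of_epi (quotShiftπ c M r (n + 1)) x
    obtain ⟨T₂, p₂, _, e', he'⟩ := exists_eq_smul_of_comp_quotShiftπ (c := c) M r n
      (e ≫ tr M (Nat.add_le_add_right n.le_succ r)) (by
        rw [Category.assoc, ← quotShiftπ_tr M r n.le_succ, ← reassoc_of% he]
        erw [hx]
        rw [comp_zero])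
    have := epi_tr hM.epi (Nat.add_le_add_right n.le_succ r)
    obtain ⟨T₃, p₃, _, e'', he''⟩ := surjective_up_to_refinements_of_epi
      (tr M (Nat.add_le_add_right n.le_succ r)) e'
    obtain ⟨T₄, p₄, _, z, hz⟩ := hr.of_le hM.epi (Nat.add_le_add_right n.le_succ r)
      (p₃ ≫ p₂ ≫ e - c ^ (n + 1) • e'') (by
        rw [Preadditive.sub_comp, Linear.smul_comp, ← he'', Category.assoc, Category.assoc, he',
          Linear.comp_smul, sub_self])
    refine ⟨T₄, p₄ ≫ p₃ ≫ p₂ ≫ p₁, inferInstance,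
      (p₄ ≫ e'' + z) ≫ quotShiftπ c M r (n + 1), ?_⟩
    rw [Preadditive.comp_sub, sub_eq_iff_eq_add'] at hz
    rw [← Linear.smul_comp, smul_add, ← Linear.comp_smul, ← hz]
    simp only [Category.assoc]
    rw [he]

lemma isStrict.isARAdic {M : ℕᵒᵖ ⥤ A} (hM : isStrict A c M) : isARAdic A c M := by
  obtain ⟨r, hr⟩ := hM.exists_kernelBound
  have hd (n : ℕ) : c ^ (n + 1) • 𝟙 (M.obj (op (n + r))) ≫ tr M (n.le_add_right r) = 0 := by
    rw [hM.bounded.smul_eq_zero n.lt_succ_self]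
  let d (n : ℕ) : (quotShift c M r).obj (op n) ⟶ M.obj (op n) :=
    cokernel.desc (c ^ (n + 1) • 𝟙 (M.obj (op (n + r)))) (tr M (n.le_add_right r))
      (by rw [Linear.smul_comp]; exact hd n)
  have πd (n : ℕ) : quotShiftπ c M r n ≫ d n = tr M (n.le_add_right r) := cokernel.π_desc _ _ _
  let f : quotShift c M r ⟶ M := mkHom d fun {m n} h => by
    rw [← cancel_epi (quotShiftπ c M r n), reassoc_of% (πd n), reassoc_of% (quotShiftπ_tr M r h), πd]
    simp
  have πf (n : ℕ) : quotShiftπ c M r n ≫ f.app (op n) = tr M (n.le_add_right r) := πd n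
  have htr (n : ℕ) : Epi (tr M (n.le_add_right r)) := epi_tr hM.epi _
  have (k : ℕᵒᵖ) : Epi (f.app k) := epi_of_epi_fac (πf k.unop)
  have : Epi f := NatTrans.epi_of_epi_app f
  refine ⟨_, f, hM.isAdic_quotShift hr, (isNull A).isoModSerre_of_epi f ⟨r, fun n => ?_⟩⟩
  rw [← cancel_mono ((kernel.ι f).app (op n)), ← app_tr, zero_comp]
  obtain ⟨T, p, _, x, hx⟩ := surjective_up_to_refinements_of_epi (quotShiftπ c M r (n + r))
    ((kernel.ι f).app (op (n + r)))
  have h0 : x ≫ tr M ((n + r).le_add_right r) = 0 := by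
    rw [← πf, ← reassoc_of% hx, kernel_ι_app, comp_zero]
  rw [← cancel_epi p, reassoc_of% hx, quotShiftπ_tr,
    reassoc_of% h0, zero_comp, comp_zero]

lemma isAdic.isStrict_of_epi {P M : ℕᵒᵖ ⥤ A} (hP : isAdic A c P) (f : P ⟶ M) [Epi f]
    (hf : isNull A (kernel f)) : InvSystem.isStrict A c M where
  bounded := (isBounded A c).prop_of_epi f hP.bounded
  epi n := by
    have := hP.epi n
    exact epi_of_epi_fac (app_tr f n.le_succ).symm.symm
  noetherian n := isNoetherianObject.prop_of_epi (f.app (op n)) (hP.noetherian n)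
  exists_kernelBound := by
    obtain ⟨r, hr⟩ := hf
    refine ⟨r, fun n T x hx => ?_⟩
    obtain ⟨T₁, p₁, _, y, hy⟩ := surjective_up_to_refinements_of_epi (f.app (op (n + r + 1))) x
    obtain ⟨T₂, p₂, _, z, hz⟩ := exact_kernel f (n + r) (y ≫ tr P (n + r).le_succ) (by
      rw [Category.assoc, ← app_tr, ← reassoc_of% hy]
      erw [hx]
      rw [comp_zero])
    obtain ⟨T₃, p₃, _, t, ht⟩ := hP.exists_smul (show n ≤ n + r + 1 by lia) (p₂ ≫ y) (by
      have := congr($hz ≫ tr P (n.le_add_right r))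
      rw [Category.assoc z, app_tr, hr, zero_comp, comp_zero] at this
      simpa using this)
    refine ⟨T₃, p₃ ≫ p₂ ≫ p₁, inferInstance, t ≫ f.app _, ?_⟩
    rw [← Linear.smul_comp, ← ht, Category.assoc, Category.assoc, hy]
    simp

end InvSystem

/-! #### Kernels, cokernels and morphisms which are isomorphisms modulo a Serre class -/

namespace CategoryTheory.ObjectProperty

variable {B : Type u} [Category.{v} B] [Abelian B] (P : ObjectProperty B) [P.IsSerreClass]

lemma monoModSerre_of_exact {X Y Z : B} {f : X ⟶ Y} {g : Y ⟶ Z} {w : f ≫ g = 0}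
    (hS : (ShortComplex.mk f g w).Exact) (h : P X) : P.monoModSerre g := by
  have := (ShortComplex.exact_iff_epi_kernel_lift _).1 hS
  exact P.prop_of_epi (kernel.lift g f w) h

lemma epiModSerre_of_exact {X Y Z : B} {f : X ⟶ Y} {g : Y ⟶ Z} {w : f ≫ g = 0}
    (hS : (ShortComplex.mk f g w).Exact) (h : P Z) : P.epiModSerre f := by
  have := (ShortComplex.exact_iff_mono_cokernel_desc _).1 hS
  exact P.prop_of_mono (cokernel.desc f g w) h

variable {X Y Z : B} (f : X ⟶ Y) (g : Y ⟶ Z)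

lemma isoModSerre_kernel_map_comp_left (hf : P.isoModSerre f) :
    P.isoModSerre (kernel.map (f ≫ g) g f (𝟙 Z) (Category.comp_id _)) :=
  ⟨P.monoModSerre_of_exact ((kernelCokernelCompSequence_exact f g).exact 0) hf.1,
    P.epiModSerre_of_exact ((kernelCokernelCompSequence_exact f g).exact 1) hf.2⟩

lemma isoModSerre_kernel_map_comp_right (hg : P.monoModSerre g) :
    P.isoModSerre (kernel.map f (f ≫ g) (𝟙 X) g (Category.id_comp _).symm) :=
  ⟨by
    have : Mono (kernel.map f (f ≫ g) (𝟙 X) g (Category.id_comp _).symm) := by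
      refine mono_of_mono_fac (kernel.lift_ι _ _ _) (h := kernel.ι f ≫ 𝟙 X)
    exact P.monoModSerre_of_mono _,
    P.epiModSerre_of_exact ((kernelCokernelCompSequence_exact f g).exact 0) hg⟩

lemma isoModSerre_cokernel_map_comp_right (hg : P.isoModSerre g) :
    P.isoModSerre (cokernel.map f (f ≫ g) (𝟙 X) g (Category.id_comp _).symm) :=
  ⟨P.monoModSerre_of_exact ((kernelCokernelCompSequence_exact f g).exact 2) hg.1,
    P.epiModSerre_of_exact ((kernelCokernelCompSequence_exact f g).exact 3) hg.2⟩

lemma isoModSerre_cokernel_map_comp_left (hf : P.epiModSerre f) :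
    P.isoModSerre (cokernel.map (f ≫ g) g f (𝟙 Z) (Category.comp_id _)) :=
  ⟨P.monoModSerre_of_exact ((kernelCokernelCompSequence_exact f g).exact 3) hf, by
    have : Epi (cokernel.map (f ≫ g) g f (𝟙 Z) (Category.comp_id _)) := by
      refine epi_of_epi_fac (cokernel.π_desc _ _ _) (h := 𝟙 Z ≫ cokernel.π g)
    exact P.epiModSerre_of_epi _⟩

lemma exists_isoModSerre_cokernel {k : X ⟶ Y} {p : Y ⟶ Z} {w : k ≫ p = 0}
    (hS : (ShortComplex.mk k p w).ShortExact) {W : B} (i : W ⟶ X) (hi : P.epiModSerre i) :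
    ∃ v : cokernel (i ≫ k) ⟶ Z, P.isoModSerre v := by
  have : Epi p := hS.epi_g
  have : Mono (cokernel.desc k p w) := (ShortComplex.exact_iff_mono_cokernel_desc _).1 hS.exact
  have : Epi (cokernel.desc k p w) := epi_of_epi_fac (cokernel.π_desc k p w)
  have := isIso_of_mono_of_epi (cokernel.desc k p w)
  exact ⟨_, P.isoModSerre.comp_mem _ (cokernel.desc k p w)
    (P.isoModSerre_cokernel_map_comp_left i k hi) (P.isoModSerre_of_isIso _)⟩

end CategoryTheory.ObjectProperty

lemma CategoryTheory.ShortComplex.ShortExact.exists_pullback {B : Type u} [Category.{v} B]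
    [Abelian B] {S : ShortComplex B} (hS : S.ShortExact) {Y : B} (b : Y ⟶ S.X₃) :
    ∃ (E : B) (u : E ⟶ S.X₂) (k : S.X₁ ⟶ E) (p : E ⟶ Y) (w : k ≫ p = 0),
      (ShortComplex.mk k p w).ShortExact ∧ IsPullback p u b S.g := by
  have := hS.mono_f
  have := hS.epi_g
  have h := IsPullback.of_hasPullback b S.g
  let k : S.X₁ ⟶ pullback b S.g := pullback.lift 0 S.f (by simp)
  have hk₁ : k ≫ pullback.fst b S.g = 0 := pullback.lift_fst _ _ _
  have hk₂ : k ≫ pullback.snd b S.g = S.f := pullback.lift_snd _ _ _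
  refine ⟨_, pullback.snd b S.g, k, pullback.fst b S.g, hk₁, ?_, h⟩
  refine { exact := ?_, mono_f := mono_of_mono_fac hk₂, epi_g := inferInstance }
  rw [ShortComplex.exact_iff_exact_up_to_refinements]
  intro T x hx
  replace hx : x ≫ pullback.fst b S.g = 0 := hx
  obtain ⟨T', p, hp, y, hy⟩ := hS.exact.exact_up_to_refinements (x ≫ pullback.snd b S.g) (by
    rw [Category.assoc, ← pullback.condition, reassoc_of% hx, zero_comp])
  refine ⟨T', p, hp, y, h.hom_ext ?_ ?_⟩
  · simp [hx, hk₁]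
  · simpa [hk₂] using hy

namespace InvSystem

open Opposite ZeroObject

variable {A : Type u} [Category.{v} A] [Abelian A] {R : Type w} [CommRing R] [Linear R A] {c : R}

/-! #### Kernels, cokernels and extensions of adic systems -/

lemma isAdic.prop_cokernel {M N : ℕᵒᵖ ⥤ A} (hM : isAdic A c M) (hN : isAdic A c N) (f : M ⟶ N) :
    isAdic A c (cokernel f) where
  bounded := (isBounded A c).prop_of_epi (cokernel.π f) hN.bounded
  epi n := by
    have := hN.epi n
    exact epi_of_epi_fac (app_tr (cokernel.π f) n.le_succ).symm.symm
  noetherian n := isNoetherianObject.prop_of_epi ((cokernel.π f).app (op n)) (hN.noetherian n)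
  kernelBound n T x hx := by
    obtain ⟨T₁, p₁, _, y, hy⟩ :=
      surjective_up_to_refinements_of_epi ((cokernel.π f).app (op (n + 1))) x
    obtain ⟨T₂, p₂, _, m, hm⟩ := exact_app (ShortComplex.exact_cokernel f) n
      (y ≫ tr N n.le_succ) (by
        change _ ≫ (cokernel.π f).app _ = 0
        rw [Category.assoc, ← app_tr, ← reassoc_of% hy]
        erw [hx]
        rw [comp_zero])
    have := hM.epi n
    obtain ⟨T₃, p₃, _, m', hm'⟩ := surjective_up_to_refinements_of_epi (tr M n.le_succ) m
    obtain ⟨T₄, p₄, _, z, hz⟩ := hN.exists_smul (m := n + 1) n.le_succ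
      (p₃ ≫ p₂ ≫ y - m' ≫ f.app (op (n + 1))) (by
        rw [Preadditive.sub_comp, Category.assoc, Category.assoc, hm, reassoc_of% hm',
          Category.assoc, app_tr, sub_self])
    have hf : f.app (op (n + 1)) ≫ (cokernel.π f).app (op (n + 1)) = 0 := by
      rw [← NatTrans.comp_app, cokernel.condition]; rfl
    refine ⟨T₄, p₄ ≫ p₃ ≫ p₂ ≫ p₁, inferInstance, z ≫ (cokernel.π f).app _, ?_⟩
    rw [← Linear.smul_comp, ← hz]
    simp only [Category.assoc, Preadditive.sub_comp]
    rw [hf, comp_zero, sub_zero, hy]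

/-- The image in `M_0` of the kernel of `c ^ n` on `M_n`. -/
noncomputable def torsionImage (c : R) (M : ℕᵒᵖ ⥤ A) (n : ℕ) : Subobject (M.obj (op 0)) :=
  imageSubobject (kernel.ι (c ^ n • 𝟙 (M.obj (op n))) ≫ tr M n.zero_le)

lemma torsionImage_factors_iff (M : ℕᵒᵖ ⥤ A) (n : ℕ) {T : A} (x : T ⟶ M.obj (op 0)) :
    (torsionImage c M n).Factors x ↔
      ∃ (T' : A) (p : T' ⟶ T) (_ : Epi p) (y : T' ⟶ M.obj (op n)),
        c ^ n • y = 0 ∧ p ≫ x = y ≫ tr M n.zero_le := by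
  rw [torsionImage, imageSubobject_factors_iff]
  constructor
  · rintro ⟨T', p, hp, y, hy⟩
    refine ⟨T', p, hp, y ≫ kernel.ι _, ?_, by rw [hy, Category.assoc]⟩
    have h := kernel.condition (c ^ n • 𝟙 (M.obj (op n)))
    rw [Linear.comp_smul, Category.comp_id] at h
    rw [← Linear.comp_smul, h, comp_zero]
  · rintro ⟨T', p, hp, y, hy, hy'⟩
    exact ⟨T', p, hp, kernel.lift _ y (by rw [Linear.comp_smul, Category.comp_id, hy]), by simp [hy']⟩

lemma isPreadic.monotone_torsionImage {M : ℕᵒᵖ ⥤ A} (hM : isPreadic A c M) :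
    Monotone (torsionImage c M) := by
  refine monotone_nat_of_le_succ fun n => Subobject.le_of_factors ?_
  have h := Subobject.factors_self (torsionImage c M n)
  rw [torsionImage_factors_iff] at h ⊢
  obtain ⟨T, p, _, y, hy, hy'⟩ := h
  have := hM.epi n
  obtain ⟨T₁, p₁, _, z, hz⟩ := surjective_up_to_refinements_of_epi (tr M n.le_succ) y
  obtain ⟨T₂, p₂, _, t, ht⟩ := hM.exists_smul n.le_succ (c ^ n • z)
    (by rw [Linear.smul_comp, ← hz, ← Linear.comp_smul, hy, comp_zero])
  refine ⟨T₂, p₂ ≫ p₁ ≫ p, inferInstance, p₂ ≫ z, ?_, ?_⟩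
  · rw [pow_succ', mul_smul, ← Linear.comp_smul, ht, smul_smul, ← pow_succ',
      hM.bounded.smul_eq_zero (Nat.lt_succ_self _)]
  · have := congr(p₂ ≫ $hz ≫ tr M n.zero_le)
    simp only [Category.assoc, tr_tr] at this ⊢
    rw [hy', this]

lemma isAdic.exists_stable {Q : ℕᵒᵖ ⥤ A} (hQ : isAdic A c Q) :
    ∃ r : ℕ, ∀ (n : ℕ) {T : A} (q : T ⟶ Q.obj (op (n + r + 1))), c ^ (n + r + 1) • q = 0 →
      ∃ (T' : A) (p : T' ⟶ T) (_ : Epi p) (q' : T' ⟶ Q.obj (op (n + r + 1))),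
        c ^ r • p ≫ q = c ^ (r + 1) • q' := by
  have : IsNoetherianObject (Q.obj (op 0)) := ⟨hQ.noetherian 0⟩
  obtain ⟨r, hr⟩ := monotone_chain_condition_of_isNoetherianObject
    ⟨torsionImage c Q, hQ.monotone_torsionImage⟩
  refine ⟨r, fun n T q hq => ?_⟩
  have h : (torsionImage c Q r).Factors (q ≫ tr Q (Nat.zero_le _)) := by
    have : torsionImage c Q r = torsionImage c Q (n + r + 1) := hr _ (by lia)
    rw [this, torsionImage_factors_iff]
    exact ⟨T, 𝟙 T, inferInstance, q, hq, Category.id_comp _⟩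
  rw [torsionImage_factors_iff] at h
  obtain ⟨T₁, p₁, _, t, ht, ht'⟩ := h
  have hle : r ≤ n + r + 1 := by lia
  obtain ⟨T₂, p₂, _, z, hz⟩ := hQ.exists_smul r.zero_le (p₁ ≫ q ≫ tr Q hle - t)
    (by rw [Preadditive.sub_comp, Category.assoc, Category.assoc, tr_tr, ht', sub_self])
  obtain ⟨T₃, p₃, _, q', hq'⟩ := hQ.exists_smul hle (c ^ r • p₂ ≫ p₁ ≫ q) (by
    rw [Preadditive.comp_sub, sub_eq_iff_eq_add] at hz
    rw [Linear.smul_comp, Category.assoc, Category.assoc, hz, smul_add, smul_smul, ← pow_add,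
      hQ.bounded.smul_eq_zero (by lia), ← Linear.comp_smul, ht, comp_zero, add_zero])
  exact ⟨T₃, p₃ ≫ p₂ ≫ p₁, inferInstance, q', by rw [← hq', Linear.comp_smul]; simp⟩

lemma isAdic.isStrict_kernel {N Q : ℕᵒᵖ ⥤ A} (hN : isAdic A c N) (hQ : isAdic A c Q)
    (f : N ⟶ Q) [Epi f] : InvSystem.isStrict A c (kernel f) where
  bounded := (isBounded A c).prop_of_mono (kernel.ι f) hN.bounded
  noetherian n := isNoetherianObject.prop_of_mono ((kernel.ι f).app (op n)) (hN.noetherian n)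
  epi n := by
    rw [epi_iff_surjective_up_to_refinements]
    intro T y
    have := hN.epi n
    obtain ⟨T₁, p₁, _, x, hx⟩ := surjective_up_to_refinements_of_epi (tr N n.le_succ)
      (y ≫ (kernel.ι f).app (op n))
    obtain ⟨T₂, p₂, _, q, hq⟩ := hQ.exists_smul n.le_succ (x ≫ f.app (op (n + 1))) (by
      rw [Category.assoc, app_tr, ← reassoc_of% hx, kernel_ι_app, comp_zero, comp_zero])
    obtain ⟨T₃, p₃, _, t, ht⟩ := surjective_up_to_refinements_of_epi (f.app (op (n + 1))) q
    obtain ⟨T₄, p₄, _, z, hz⟩ := exact_kernel f (n + 1) (p₃ ≫ p₂ ≫ x - c ^ (n + 1) • t) (by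
      rw [Preadditive.sub_comp, Category.assoc, Category.assoc, hq, Linear.smul_comp, ← ht,
        Linear.comp_smul, sub_self])
    refine ⟨T₄, p₄ ≫ p₃ ≫ p₂ ≫ p₁, inferInstance, z, ?_⟩
    rw [← cancel_mono ((kernel.ι f).app (op n)), Category.assoc z, ← app_tr, ← reassoc_of% hz,
      Preadditive.sub_comp, Linear.smul_comp, hN.bounded.smul_eq_zero n.lt_succ_self, sub_zero]
    simp only [Category.assoc, hx]
  exists_kernelBound := by
    obtain ⟨r, hr⟩ := hQ.exists_stable
    refine ⟨r, fun n T x hx => ?_⟩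
    obtain ⟨T₁, p₁, _, y, hy⟩ := hN.exists_smul (n + r).le_succ
      (x ≫ (kernel.ι f).app (op (n + r + 1))) (by
        rw [Category.assoc, app_tr, ← Category.assoc]
        erw [hx]
        rw [zero_comp])
    obtain ⟨T₂, p₂, _, q, hq⟩ := hr n (y ≫ f.app (op (n + r + 1))) (by
      rw [← Linear.smul_comp, ← hy, Category.assoc, Category.assoc, kernel_ι_app, comp_zero,
        comp_zero])
    obtain ⟨T₃, p₃, _, t, ht⟩ := surjective_up_to_refinements_of_epi (f.app (op (n + r + 1))) q
    obtain ⟨T₄, p₄, _, z, hz⟩ := exact_kernel f (n + r + 1)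
      (c ^ r • p₃ ≫ p₂ ≫ y - c ^ (r + 1) • t) (by
        have := congr(p₃ ≫ $hq)
        rw [Preadditive.sub_comp, Linear.smul_comp, Linear.smul_comp, ← ht, sub_eq_zero]
        simpa using this)
    refine ⟨T₄, p₄ ≫ p₃ ≫ p₂ ≫ p₁, inferInstance, z, ?_⟩
    rw [← cancel_mono ((kernel.ι f).app (op (n + r + 1))), Linear.smul_comp, ← hz,
      ← Linear.comp_smul, smul_sub, smul_smul, smul_smul, ← pow_add, ← pow_add,
      hN.bounded.smul_eq_zero (show n + r + 1 < n + 1 + (r + 1) by lia), sub_zero]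
    simp only [Category.assoc, hy, Linear.comp_smul]
    rw [show n + 1 + r = n + r + 1 by lia]

lemma isStrict.of_shortExact {S : ShortComplex (ℕᵒᵖ ⥤ A)} (hS : S.ShortExact)
    (h₁ : InvSystem.isStrict A c S.X₁) (h₂ : isBounded A c S.X₂) (h₃ : isAdic A c S.X₃) :
    InvSystem.isStrict A c S.X₂ where
  bounded := h₂
  noetherian n := isNoetherianObject.prop_X₂_of_shortExact
    (hS.map_of_exact ((evaluation ℕᵒᵖ A).obj (op n))) (h₁.noetherian n) (h₃.noetherian n)
  epi n := by
    have := hS.epi_g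
    rw [epi_iff_surjective_up_to_refinements]
    intro T y
    have := h₃.epi n
    have := h₁.epi n
    obtain ⟨T₁, p₁, _, b, hb⟩ := surjective_up_to_refinements_of_epi (tr S.X₃ n.le_succ)
      (y ≫ S.g.app (op n))
    obtain ⟨T₂, p₂, _, e, he⟩ := surjective_up_to_refinements_of_epi (S.g.app (op (n + 1))) b
    obtain ⟨T₃, p₃, _, a, ha⟩ := exact_app hS.exact n (p₂ ≫ p₁ ≫ y - e ≫ tr S.X₂ n.le_succ) (by
      rw [Preadditive.sub_comp, Category.assoc, Category.assoc, Category.assoc, hb, ← app_tr,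
        ← reassoc_of% he]
      exact sub_self _)
    obtain ⟨T₄, p₄, _, a', ha'⟩ := surjective_up_to_refinements_of_epi (tr S.X₁ n.le_succ) a
    refine ⟨T₄, p₄ ≫ p₃ ≫ p₂ ≫ p₁, inferInstance, p₄ ≫ p₃ ≫ e + a' ≫ S.f.app (op (n + 1)), ?_⟩
    rw [Preadditive.add_comp, Category.assoc a', app_tr, ← reassoc_of% ha', ← ha]
    simp
  exists_kernelBound := by
    have := hS.epi_g
    have := hS.mono_f
    obtain ⟨r, hr⟩ := h₁.exists_kernelBound
    refine ⟨r, fun n T x hx => ?_⟩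
    obtain ⟨T₁, p₁, _, b, hb⟩ := h₃.exists_smul (n + r).le_succ (x ≫ S.g.app (op (n + r + 1))) (by
      rw [Category.assoc, app_tr, ← Category.assoc]
      erw [hx]
      rw [zero_comp])
    obtain ⟨T₂, p₂, _, e, he⟩ := surjective_up_to_refinements_of_epi (S.g.app (op (n + r + 1))) b
    obtain ⟨T₃, p₃, _, a, ha⟩ := exact_app hS.exact (n + r + 1)
      (p₂ ≫ p₁ ≫ x - c ^ (n + r + 1) • e) (by
        rw [Preadditive.sub_comp, Category.assoc, Category.assoc, hb, Linear.smul_comp, ← he,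
          Linear.comp_smul, sub_self])
    obtain ⟨T₄, p₄, _, z, hz⟩ := hr n a (by
      rw [← cancel_mono (S.f.app (op (n + r))), Category.assoc]
      erw [← app_tr]
      rw [← reassoc_of% ha, Preadditive.sub_comp, Linear.smul_comp,
        h₂.smul_eq_zero (n + r).lt_succ_self, sub_zero]
      erw [Category.assoc, Category.assoc, hx]
      simp)
    refine ⟨T₄, p₄ ≫ p₃ ≫ p₂ ≫ p₁, inferInstance,
      p₄ ≫ p₃ ≫ (c ^ r • e) + z ≫ S.f.app (op (n + r + 1)), ?_⟩
    rw [Preadditive.comp_sub, sub_eq_iff_eq_add'] at ha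
    have h := congr(p₄ ≫ $ha)
    rw [Preadditive.comp_add, reassoc_of% hz] at h
    simp only [Category.assoc] at h ⊢
    rw [h, smul_add, Linear.smul_comp]
    simp only [Linear.comp_smul, smul_smul, ← pow_add]
    rw [show n + 1 + r = n + r + 1 by lia]

lemma isARAdic.prop_cokernel {M N : ℕᵒᵖ ⥤ A} (hM : isARAdic A c M) (hN : isARAdic A c N)
    (f : M ⟶ N) : isARAdic A c (cokernel f) := by
  obtain ⟨P, a, hP, ha⟩ := hM
  obtain ⟨Q, b, hQ, hb⟩ := hN
  obtain ⟨g, hg⟩ := hP.exists_lift hQ.bounded b hb (a ≫ f)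
  have h := (hP.prop_cokernel hQ g).isStrict.isARAdic.of_isoModSerre _
    ((isNull A).isoModSerre_cokernel_map_comp_right g b hb)
  rw [hg] at h
  exact h.of_isoModSerre _ ((isNull A).isoModSerre_cokernel_map_comp_left a f ha.2)

lemma isAdic.isARAdic_kernel {M N : ℕᵒᵖ ⥤ A} (hM : isAdic A c M) (hN : isAdic A c N)
    (f : M ⟶ N) : isARAdic A c (kernel f) := by
  have hI := hN.isStrict_kernel (hM.prop_cokernel hN f) (cokernel.π f)
  obtain ⟨I, b, hI', hb⟩ := hI.isARAdic
  obtain ⟨g, hg⟩ := hM.exists_lift hI'.bounded b hb (Abelian.factorThruImage f)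
  have hg' : (isNull A).epiModSerre g := by
    refine (isNull A).prop_X₂_of_exact ((kernelCokernelCompSequence_exact g b).exact 2) hb.1 ?_
    change (isNull A).epiModSerre (g ≫ b)
    rw [hg]
    exact (isNull A).epiModSerre_of_epi _
  have : Epi g := Preadditive.epi_of_cokernel_zero (eq_zero_of_isNull hI'.epi hg' _)
  have hfac : g ≫ b ≫ Abelian.image.ι f = f := by
    rw [reassoc_of% hg, Abelian.image.fac]
  have h := (hM.isStrict_kernel hI' g).isARAdic.of_isoModSerre _
    ((isNull A).isoModSerre_kernel_map_comp_right g (b ≫ Abelian.image.ι f)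
      (MorphismProperty.comp_mem _ _ _ hb.1 ((isNull A).monoModSerre_of_mono _)))
  rwa [hfac] at h

lemma isARAdic.prop_kernel {M N : ℕᵒᵖ ⥤ A} (hM : isARAdic A c M) (hN : isARAdic A c N)
    (f : M ⟶ N) : isARAdic A c (kernel f) := by
  obtain ⟨P, a, hP, ha⟩ := hM
  obtain ⟨Q, b, hQ, hb⟩ := hN
  obtain ⟨g, hg⟩ := hP.exists_lift hQ.bounded b hb (a ≫ f)
  have h := (hP.isARAdic_kernel hQ g).of_isoModSerre _
    ((isNull A).isoModSerre_kernel_map_comp_right g b hb.1)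
  rw [hg] at h
  exact h.of_isoModSerre _ ((isNull A).isoModSerre_kernel_map_comp_left a f ha)

lemma isARAdic.of_shortExact {S : ShortComplex (ℕᵒᵖ ⥤ A)} (hS : S.ShortExact)
    (h₁ : isARAdic A c S.X₁) (h₂ : isBounded A c S.X₂) (h₃ : isARAdic A c S.X₃) :
    isARAdic A c S.X₂ := by
  obtain ⟨P, b, hP, hb⟩ := h₃
  obtain ⟨Q, a, hQ, ha⟩ := h₁
  obtain ⟨E, u, k, p, w, hE, sq⟩ := hS.exists_pullback b
  have := hE.mono_f
  have := hE.epi_g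
  dsimp at this
  have hu : (isNull A).isoModSerre u := MorphismProperty.of_isPullback sq hb
  refine isARAdic.of_isoModSerre u hu ?_
  have hE' : isBounded A c E := fun n =>
    (sq.map ((evaluation ℕᵒᵖ A).obj (op n))).hom_ext
      (by
        dsimp
        rw [Linear.smul_comp, hP.bounded.smul_eq_zero n.lt_succ_self, zero_comp])
      (by
        dsimp
        rw [Linear.smul_comp, h₂.smul_eq_zero n.lt_succ_self, zero_comp])
  let j := Abelian.image.ι a ≫ k
  have hj : (ShortComplex.mk j (cokernel.π j) (cokernel.condition j)).ShortExact :=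
    { exact := ShortComplex.exact_cokernel j
      mono_f := mono_comp _ _ }
  obtain ⟨v, hv⟩ := (isNull A).exists_isoModSerre_cokernel hE (Abelian.image.ι a)
    (ObjectProperty.epiModSerre.isoModSerre_image_ι ha.2).2
  obtain ⟨s, hs⟩ := hP.exists_lift ((isBounded A c).prop_of_epi (cokernel.π j) hE') v hv (𝟙 P)
  have hs' : (isNull A).isoModSerre s :=
    (isNull A).isoModSerre.of_postcomp (W' := (isNull A).isoModSerre) s v hv
      (hs.symm ▸ (isNull A).isoModSerre_of_isIso (𝟙 P))
  have : Mono s := mono_of_mono_fac hs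
  obtain ⟨F, u', k', p', w', hF, sq'⟩ := hj.exists_pullback s
  refine isARAdic.of_isoModSerre u' (MorphismProperty.of_isPullback sq' hs') ?_
  have : Mono u' := MorphismProperty.of_isPullback (P := .monomorphisms _) sq' ‹Mono s›
  refine (isStrict.of_shortExact hF ?_ ((isBounded A c).prop_of_mono u' hE') hP).isARAdic
  exact hQ.isStrict_of_epi (Abelian.factorThruImage a) ha.1.isoModSerre_factorThruImage.1

end InvSystem

/-! ### Thick subcategories and complexes with cohomology in a thick subcategory -/

section Thick

variable {B : Type u} [Category.{v} B] [Abelian B] (P : ObjectProperty B)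

instance [P.IsSerreClass] : IsThickSubcategory P where

variable [IsThickSubcategory P]

lemma IsThickSubcategory.prop_of_exact {X₁ X₂ X₃ X₄ X₅ : B} {f₁ : X₁ ⟶ X₂} {f₂ : X₂ ⟶ X₃}
    {f₃ : X₃ ⟶ X₄} {f₄ : X₄ ⟶ X₅} {w₁₂ : f₁ ≫ f₂ = 0} {w₂₃ : f₂ ≫ f₃ = 0} {w₃₄ : f₃ ≫ f₄ = 0}
    (h₁₂ : (ShortComplex.mk f₁ f₂ w₁₂).Exact) (h₂₃ : (ShortComplex.mk f₂ f₃ w₂₃).Exact)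
    (h₃₄ : (ShortComplex.mk f₃ f₄ w₃₄).Exact) (h₁ : P X₁) (h₂ : P X₂) (h₄ : P X₄) (h₅ : P X₅) :
    P X₃ := by
  let d : cokernel f₁ ⟶ X₃ := cokernel.desc f₁ f₂ w₁₂
  let l : X₃ ⟶ kernel f₄ := kernel.lift f₄ f₃ w₃₄
  have hd : cokernel.π f₁ ≫ d = f₂ := cokernel.π_desc _ _ _
  have hl : l ≫ kernel.ι f₄ = f₃ := kernel.lift_ι _ _ _
  have hdl : d ≫ l = 0 := by
    rw [← cancel_epi (cokernel.π f₁), ← cancel_mono (kernel.ι f₄), reassoc_of% hd, Category.assoc,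
      hl, w₂₃, comp_zero, zero_comp]
  have hS : (ShortComplex.mk d l hdl).ShortExact :=
    { exact := by
        rw [ShortComplex.exact_iff_exact_up_to_refinements]
        intro T x hx
        replace hx : x ≫ l = 0 := hx
        obtain ⟨T', p, hp, y, hy⟩ := h₂₃.exact_up_to_refinements x
          (by change x ≫ f₃ = 0; rw [← hl, reassoc_of% hx, zero_comp])
        refine ⟨T', p, hp, y ≫ cokernel.π f₁, ?_⟩
        change _ = (y ≫ cokernel.π f₁) ≫ d
        rw [Category.assoc, hd, hy]
      mono_f := (ShortComplex.exact_iff_mono_cokernel_desc _).1 h₁₂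
      epi_g := (ShortComplex.exact_iff_epi_kernel_lift _).1 h₃₄ }
  exact P.prop_X₂_of_shortExact hS (P.prop_cokernel f₁ h₁ h₂) (P.prop_kernel f₄ h₄ h₅)

lemma IsThickSubcategory.prop_of_retract {X Y : B} (r : Retract X Y) (hY : P Y) : P X := by
  have w : r.i ≫ (𝟙 Y - r.r ≫ r.i) = 0 := by
    rw [Preadditive.comp_sub, r.retract_assoc, Category.comp_id, sub_self]
  refine P.prop_of_isLimit_kernelFork (k := KernelFork.ofι r.i w) ?_ hY hY
  refine KernelFork.IsLimit.ofι _ _ (fun g _ => g ≫ r.r) (fun g hg => ?_) (fun g hg m hm => ?_)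
  · rw [Preadditive.comp_sub, Category.comp_id, sub_eq_zero] at hg
    rw [Category.assoc, ← hg]
  · rw [← hm, Category.assoc, r.retract, Category.comp_id]

instance [HasDerivedCategory.{w} B] : IsThickTriangulated (cohomologyIn P) :=
  have : (cohomologyIn P).IsClosedUnderIsomorphisms :=
    ⟨fun e h i => P.prop_of_iso ((DerivedCategory.homologyFunctor B i).mapIso e) (h i)⟩
  have ⟨Z, hZ⟩ := HasZeroObject.zero (C := DerivedCategory B)
  { exists_zero := ⟨Z, hZ, fun _ => P.prop_of_isZero (Functor.map_isZero _ hZ)⟩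
    isStableUnderShiftBy := fun a => ⟨fun X hX i => P.prop_of_iso
      (((DerivedCategory.homologyFunctor B 0).shiftIso a i (i + a) (add_comm _ _)).symm.app X)
      (hX (i + a))⟩
    toIsTriangulatedClosed₂ := .mk' fun T hT h₁ h₃ i =>
      IsThickSubcategory.prop_of_exact P
        (DerivedCategory.HomologySequence.exact₁ T hT (i - 1) i)
        (DerivedCategory.HomologySequence.exact₂ T hT i)
        (DerivedCategory.HomologySequence.exact₃ T hT i (i + 1))
        (h₃ _) (h₁ _) (h₃ _) (h₁ _)
    of_retract := fun r h i => IsThickSubcategory.prop_of_retract P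
      (r.map (DerivedCategory.homologyFunctor B i)) (h i) }

end Thick

/-! ### Restriction of scalars along a quotient map, for sheaves of modules -/

section RestrictScalars

instance ModuleCat.restrictScalars_quotient_full {S : Type u} [CommRing S] (I : Ideal S) :
    (ModuleCat.restrictScalars.{v} (Ideal.Quotient.mk I)).Full where
  map_surjective {M N} f := ⟨ModuleCat.ofHom
    { toFun := fun x : M => f.hom x
      map_add' := fun x y => f.hom.map_add x y
      map_smul' := fun r x => by
        obtain ⟨s, rfl⟩ := Ideal.Quotient.mk_surjective r
        exact f.hom.map_smul s x }, rfl⟩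

variable {S : Type u} [CommRing S] (I : Ideal S) {C : Type u} [SmallCategory C]
  (J : GrothendieckTopology C)

/-- Restriction of scalars from `S ⧸ I` to `S`, for sheaves of modules. -/
noncomputable abbrev sheafRestrict : Sheaf J (ModuleCat.{u} (S ⧸ I)) ⥤ Sheaf J (ModuleCat.{u} S) :=
  sheafCompose J (ModuleCat.restrictScalars (Ideal.Quotient.mk I))

instance : (sheafRestrict I J).Additive where
  map_add := rfl

instance : (sheafRestrict I J).PreservesEpimorphisms where
  preserves {F G} f hf := by
    rw [← Sheaf.isLocallySurjective_iff_epi'] at hf ⊢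
    exact ⟨fun {U} s => hf.imageSieve_mem (show G.obj.obj (Opposite.op U) from s)⟩

instance : PreservesFiniteColimits (sheafRestrict I J) :=
  (Functor.preservesFiniteColimits_iff_forall_exact_map_and_epi _).2 fun T hT =>
    have := hT.epi_g
    ⟨((Functor.preservesFiniteLimits_iff_forall_exact_map_and_mono (sheafRestrict I J)).1
      inferInstance T hT).1, inferInstance⟩

lemma smul_id_sheafRestrict_obj {c : S} (hc : c ∈ I) (F : Sheaf J (ModuleCat.{u} (S ⧸ I))) :
    c • 𝟙 ((sheafRestrict I J).obj F) = 0 := by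
  refine Sheaf.hom_ext (NatTrans.ext (funext fun U => ModuleCat.hom_ext (LinearMap.ext fun x => ?_)))
  change (Ideal.Quotient.mk I c) • (show F.obj.obj U from x) = 0
  rw [Ideal.Quotient.eq_zero_iff_mem.2 hc, zero_smul]

lemma exists_iso_sheafRestrict_obj (F : Sheaf J (ModuleCat.{u} S))
    (hF : ∀ c ∈ I, c • 𝟙 F = 0) : ∃ G, Nonempty ((sheafRestrict I J).obj G ≅ F) := by
  have h (U : Cᵒᵖ) : Module.IsTorsionBySet S (F.obj.obj U) I := fun x c => by
    have := congr(($(hF c c.2)).hom.app U x)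
    exact this
  let P : Cᵒᵖ ⥤ ModuleCat.{u} (S ⧸ I) :=
    { obj := fun U =>
        letI := (h U).module
        ModuleCat.of (S ⧸ I) (F.obj.obj U)
      map := fun {U V} f =>
        letI := (h U).module
        letI := (h V).module
        ModuleCat.ofHom
          { toFun := fun x => (F.obj.map f).hom x
            map_add' := fun x y => (F.obj.map f).hom.map_add x y
            map_smul' := fun r x => by
              obtain ⟨s, rfl⟩ := Ideal.Quotient.mk_surjective r
              exact (F.obj.map f).hom.map_smul s x }
      map_id := fun U => by ext x; exact congr($(F.obj.map_id U) x)
      map_comp := fun f g => by ext x; exact congr($(F.obj.map_comp f g) x) }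
  let e : P ⋙ ModuleCat.restrictScalars (Ideal.Quotient.mk I) ≅ F.obj :=
    NatIso.ofComponents (fun U => LinearEquiv.toModuleIso
      { toFun := fun x => x
        invFun := fun x => x
        left_inv := fun _ => rfl
        right_inv := fun _ => rfl
        map_add' := fun _ _ => rfl
        map_smul' := fun _ _ => rfl }) (fun f => by ext x; rfl)
  have hP : Presheaf.IsSheaf J P := by
    rw [Presheaf.isSheaf_iff_isSheaf_comp J P (ModuleCat.restrictScalars (Ideal.Quotient.mk I))]
    exact Presheaf.isSheaf_of_iso_iff e |>.2 F.property
  exact ⟨⟨P, hP⟩, ⟨(fullyFaithfulSheafToPresheaf J _).preimageIso e⟩⟩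

end RestrictScalars

/-! ### Fully faithful exact functors whose essential image consists of the objects killed by a
scalar -/

section Killed

variable {D : Type u} [Category.{v} D] {E : Type u} [Category.{v} E]
  (F : D ⥤ E)

section Noetherian

variable [F.Full] [F.Faithful]

lemma isNoetherianObject_of_map [F.PreservesMonomorphisms] {X : D}
    (h : isNoetherianObject (F.obj X)) : isNoetherianObject X := by
  have : WellFoundedGT (Subobject (F.obj X)) := h
  let φ : Subobject X → Subobject (F.obj X) := fun U => Subobject.mk (F.map U.arrow)
  have hφ {U V : Subobject X} : φ U ≤ φ V ↔ U ≤ V := by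
    constructor
    · intro h
      refine Subobject.le_of_comm (F.preimage (Subobject.ofMkLEMk _ _ h)) (F.map_injective ?_)
      rw [F.map_comp, F.map_preimage, Subobject.ofMkLEMk_comp]
    · intro h
      exact Subobject.mk_le_mk_of_comm (F.map (Subobject.ofLE U V h))
        (by rw [← F.map_comp, Subobject.ofLE_arrow])
  have hφ' : StrictMono φ := fun U V h =>
    lt_of_le_not_ge (hφ.2 h.le) fun h' => h.not_ge (hφ.1 h')
  exact hφ'.wellFoundedGT

lemma isNoetherianObject_map [F.ReflectsMonomorphisms] {X : D}
    (hF : ∀ {Y : E} (i : Y ⟶ F.obj X), Mono i → ∃ Z, Nonempty (F.obj Z ≅ Y))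
    (h : isNoetherianObject X) : isNoetherianObject (F.obj X) := by
  have : WellFoundedGT (Subobject X) := h
  choose Z e using fun U : Subobject (F.obj X) => hF U.arrow inferInstance
  let i (U : Subobject (F.obj X)) : Z U ⟶ X := F.preimage ((e U).some.hom ≫ U.arrow)
  have hi (U : Subobject (F.obj X)) : F.map (i U) = (e U).some.hom ≫ U.arrow := F.map_preimage _
  have (U : Subobject (F.obj X)) : Mono (i U) := by
    have : Mono (F.map (i U)) := by rw [hi]; infer_instance
    exact F.mono_of_mono_map this
  let φ : Subobject (F.obj X) → Subobject X := fun U => Subobject.mk (i U)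
  have hφ {U V : Subobject (F.obj X)} : φ U ≤ φ V ↔ U ≤ V := by
    constructor
    · intro h
      refine Subobject.le_of_comm ((e U).some.inv ≫ F.map (Subobject.ofMkLEMk _ _ h) ≫
        (e V).some.hom) ?_
      rw [Category.assoc, Category.assoc, ← hi, ← F.map_comp, Subobject.ofMkLEMk_comp, hi,
        Iso.inv_hom_id_assoc]
    · intro h
      refine Subobject.mk_le_mk_of_comm
        (F.preimage ((e U).some.hom ≫ Subobject.ofLE U V h ≫ (e V).some.inv)) (F.map_injective ?_)
      rw [F.map_comp, F.map_preimage, hi, hi, Category.assoc, Category.assoc, Iso.inv_hom_id_assoc,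
        Subobject.ofLE_arrow]
  have hφ' : StrictMono φ := fun U V h =>
    lt_of_le_not_ge (hφ.2 h.le) fun h' => h.not_ge (hφ.1 h')
  exact hφ'.wellFoundedGT

end Noetherian

variable [Abelian E] {R : Type w} [CommRing R] [Linear R E] {a : R} (hF : ∀ Z, a • 𝟙 (F.obj Z) = 0)
  {D' : Type u} [Category.{v} D'] (F' : D' ⥤ E) [F'.Full] [F'.Faithful]
  {L : D' ⥤ D} {G : D ⥤ D'} (adj : L ⊣ G) (e : G ⋙ F' ≅ F) {X' : D'} {X : D} (t : X' ⟶ G.obj X)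

include hF

lemma smul_eq_zero_of_killed {Z : D} {T : E} (x : T ⟶ F.obj Z) : a • x = 0 := by
  rw [← Category.comp_id x, ← Linear.comp_smul, hF, comp_zero]

lemma isIso_homEquiv_symm_iff [F.Full] [F.Faithful]
    (hF' : ∀ Y : E, a • 𝟙 Y = 0 → ∃ Z, Nonempty (F.obj Z ≅ Y)) :
    IsIso ((adj.homEquiv X' X).symm t) ↔
      Epi (F'.map t ≫ e.hom.app X) ∧ ∀ {T : E} (x : T ⟶ F'.obj X'),
        x ≫ F'.map t ≫ e.hom.app X = 0 → ∃ (T' : E) (p : T' ⟶ T) (_ : Epi p) (y : T' ⟶ F'.obj X'),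
          p ≫ x = a • y := by
  set s : F'.obj X' ⟶ F.obj X := F'.map t ≫ e.hom.app X with hs
  set τ := (adj.homEquiv X' X).symm t with hτ
  have hst {Z : D} (g : X ⟶ Z) : s ≫ F.map g = F'.map (t ≫ G.map g) ≫ e.hom.app Z := by
    have := e.hom.naturality g
    dsimp at this
    rw [hs, Category.assoc, ← this, F'.map_comp, Category.assoc]
  have hτt {Z : D} (g : X ⟶ Z) : adj.homEquiv X' Z (τ ≫ g) = t ≫ G.map g := by
    rw [adj.homEquiv_naturality_right, hτ, Equiv.apply_symm_apply]
  have inj {Z : D} (g h : X ⟶ Z) : s ≫ F.map g = s ≫ F.map h ↔ τ ≫ g = τ ≫ h := by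
    rw [hst, hst, cancel_mono, F'.map_injective.eq_iff, ← hτt, ← hτt, Equiv.apply_eq_iff_eq]
  have link {Z : D} (g : L.obj X' ⟶ Z) (h : X ⟶ Z) :
      s ≫ F.map h = F'.map (adj.homEquiv X' Z g) ≫ e.hom.app Z ↔ τ ≫ h = g := by
    rw [hst, cancel_mono, F'.map_injective.eq_iff, ← hτt, Equiv.apply_eq_iff_eq]
  constructor
  · intro _
    let q := cokernel.π (a • 𝟙 (F'.obj X'))
    have hq : a • q = 0 := by
      have := cokernel.condition (a • 𝟙 (F'.obj X'))
      rwa [Linear.smul_comp, Category.id_comp] at this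
    obtain ⟨Z, ⟨i⟩⟩ := hF' (cokernel (a • 𝟙 (F'.obj X'))) (by
      rw [← cancel_epi (cokernel.π _), Linear.comp_smul, Category.comp_id, hq, comp_zero])
    let g : L.obj X' ⟶ Z := (adj.homEquiv X' Z).symm (F'.preimage (q ≫ i.inv ≫ e.inv.app Z))
    have hψ : s ≫ F.map (inv τ ≫ g) ≫ i.hom = q := by
      rw [reassoc_of% (link g (inv τ ≫ g)).2 (by simp), Equiv.apply_symm_apply, F'.map_preimage]
      simp
    let φ : cokernel (a • 𝟙 (F'.obj X')) ⟶ F.obj X := cokernel.desc _ s (by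
      rw [Linear.smul_comp, Category.id_comp, smul_eq_zero_of_killed F hF])
    have hφ : q ≫ φ = s := cokernel.π_desc _ _ _
    have h₁ : (F.map (inv τ ≫ g) ≫ i.hom) ≫ φ = 𝟙 _ := by
      have h := (inj ((inv τ ≫ g) ≫ F.preimage (i.hom ≫ φ)) (𝟙 X)).1 (by
        rw [F.map_comp, F.map_preimage, F.map_id, Category.comp_id, reassoc_of% hψ, hφ])
      rw [cancel_epi] at h
      have := congr(F.map $h)
      rw [F.map_comp, F.map_preimage, F.map_id] at this
      rw [Category.assoc, this]
    have h₂ : φ ≫ F.map (inv τ ≫ g) ≫ i.hom = 𝟙 _ := by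
      rw [← cancel_epi q, reassoc_of% hφ, hψ, Category.comp_id]
    have : IsIso φ := ⟨_, h₂, h₁⟩
    refine ⟨by rw [← hφ]; infer_instance, fun x hx => ?_⟩
    rw [← hφ, ← Category.assoc, ← cancel_mono (inv φ), Category.assoc, IsIso.hom_inv_id,
      Category.comp_id, zero_comp] at hx
    obtain ⟨T', p, hp, y, hy⟩ := (CokernelCofork.IsColimit.comp_π_eq_zero_iff_up_to_refinements
      (cokernelIsCokernel (a • 𝟙 (F'.obj X'))) x).1 hx
    exact ⟨T', p, hp, y, by rw [hy, Linear.comp_smul, Category.comp_id]⟩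
  · rintro ⟨_, hker⟩
    refine isIso_of_coyoneda_map_bijective _ fun Z => ⟨fun g h hgh => ?_, fun g => ?_⟩
    · exact F.map_injective ((cancel_epi s).1 ((inj g h).2 hgh))
    · let k := F'.map (adj.homEquiv X' Z g) ≫ e.hom.app Z
      have hk : kernel.ι s ≫ k = 0 := by
        obtain ⟨T, p, _, y, hy⟩ := hker (kernel.ι s) (kernel.condition s)
        rw [← cancel_epi p, reassoc_of% hy, Linear.smul_comp, smul_eq_zero_of_killed F hF,
          comp_zero]
      exact ⟨F.preimage (Abelian.epiDesc s k hk), (link _ _).1 (by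
        rw [F.map_preimage]
        exact Abelian.comp_epiDesc s k hk)⟩

end Killed

/-- Restriction of scalars of sheaves of modules along a composition of ring homomorphisms. -/
noncomputable def sheafRestrictComp {C : Type u} [SmallCategory C] (J : GrothendieckTopology C)
    {R S T : Type u} [CommRing R] [CommRing S] [CommRing T]
    (f : R →+* S) (g : S →+* T) (gf : R →+* T) (h : gf = g.comp f) :
    sheafCompose J (ModuleCat.restrictScalars.{u} g) ⋙ sheafCompose J (ModuleCat.restrictScalars.{u} f) ≅
      sheafCompose J (ModuleCat.restrictScalars.{u} gf) where
  hom := { app := fun M => ⟨Functor.whiskerLeft M.obj (ModuleCat.restrictScalarsComp' f g gf h).inv⟩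
           naturality := fun _ _ a => Sheaf.hom_ext <| NatTrans.ext <| funext fun U =>
            (ModuleCat.restrictScalarsComp' f g gf h).inv.naturality (a.hom.app U) }
  inv := { app := fun M => ⟨Functor.whiskerLeft M.obj (ModuleCat.restrictScalarsComp' f g gf h).hom⟩ 
           naturality := fun _ _ a => Sheaf.hom_ext <| NatTrans.ext <| funext fun U =>
            (ModuleCat.restrictScalarsComp' f g gf h).hom.naturality (a.hom.app U) }
  hom_inv_id := NatTrans.ext <| funext fun M => Sheaf.hom_ext <| NatTrans.ext <| funext fun U =>
    (ModuleCat.restrictScalarsComp' f g gf h).inv_hom_id_app (M.obj.obj U)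
  inv_hom_id := NatTrans.ext <| funext fun M => Sheaf.hom_ext <| NatTrans.ext <| funext fun U =>
    (ModuleCat.restrictScalarsComp' f g gf h).hom_inv_id_app (M.obj.obj U)

/-! ### Modules over `Λ_•` as inverse systems of sheaves of `O`-modules -/

namespace LambdaMod

open Opposite

variable {O : Type u} [CommRing O] [IsLocalRing O] {C : Type u} [SmallCategory C]
  {J : GrothendieckTopology C}

variable (O J) in
/-- Restricting scalars from `Λ_n` to `Λ_{n + 1}` and then to `O` is restricting scalars
from `Λ_n` to `O`. -/
noncomputable def restrictCompToO (n : ℕ) :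
    lambdaRestrict O J n ⋙ toO O J (n + 1) ≅ toO O J n :=
  sheafRestrictComp J (Ideal.Quotient.mk _) (lambdaTrans O n) (Ideal.Quotient.mk _) rfl

lemma step_eq (M : LambdaMod O J) (n : ℕ) :
    M.step n = (toO O J (n + 1)).map (M.trans n) ≫ (restrictCompToO O J n).hom.app (M.obj n) := rfl

lemma step_naturality {M N : LambdaMod O J} (f : M ⟶ N) (n : ℕ) :
    M.step n ≫ (toO O J n).map (f.app n) = (toO O J (n + 1)).map (f.app (n + 1)) ≫ N.step n := by
  have := (restrictCompToO O J n).hom.naturality (f.app n)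
  rw [step_eq, step_eq, Category.assoc]
  erw [← this]
  rw [← Category.assoc, ← Category.assoc, ← Functor.map_comp, ← f.comm]
  simp

variable (O J) in
/-- The inverse system of sheaves of `O`-modules underlying a module over `Λ_•`. -/
noncomputable def toInvSystem : LambdaMod O J ⥤ ℕᵒᵖ ⥤ Sheaf J (ModuleCat.{u} O) where
  obj M := Functor.ofOpSequence (X := fun n => (toO O J n).obj (M.obj n)) M.step
  map {M N} f := NatTrans.ofOpSequence (fun n => (toO O J n).map (f.app n)) fun n => by
    rw [Functor.ofOpSequence_map_homOfLE_succ, Functor.ofOpSequence_map_homOfLE_succ]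
    exact step_naturality f n
  map_id M := by ext n : 2; exact (toO O J n.unop).map_id _
  map_comp f g := by ext n : 2; exact (toO O J n.unop).map_comp _ _

lemma tr_succ (M : LambdaMod O J) (n : ℕ) :
    InvSystem.tr ((toInvSystem O J).obj M) n.le_succ = M.step n :=
  Functor.ofOpSequence_map_homOfLE_succ (X := fun n => (toO O J n).obj (M.obj n)) M.step n

lemma tr_eq_transition (M : LambdaMod O J) (n r : ℕ) :
    InvSystem.tr ((toInvSystem O J).obj M) (n.le_add_right r) = M.transition n r := by
  induction r with
  | zero => exact InvSystem.tr_self _ _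
  | succ r ih =>
    rw [transition, ← ih, ← tr_succ]
    exact (InvSystem.tr_tr _ _ _).symm

instance (n : ℕ) : (toO O J n).Full :=
  inferInstanceAs (sheafRestrict (IsLocalRing.maximalIdeal O ^ (n + 1)) J).Full

instance (n : ℕ) : PreservesFiniteColimits (toO O J n) :=
  inferInstanceAs (PreservesFiniteColimits (sheafRestrict (IsLocalRing.maximalIdeal O ^ (n + 1)) J))

lemma comm_of_step {M N : LambdaMod O J} (n : ℕ) (a : M.obj (n + 1) ⟶ N.obj (n + 1))
    (b : M.obj n ⟶ N.obj n) (h : (toO O J (n + 1)).map a ≫ N.step n = M.step n ≫ (toO O J n).map b) :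
    M.trans n ≫ (lambdaRestrict O J n).map b = a ≫ N.trans n := by
  rw [step_eq, step_eq, Category.assoc] at h
  refine (toO O J (n + 1)).map_injective
    (((Iso.app (restrictCompToO O J n) (N.obj n)).cancel_iso_hom_right _ _).1 ?_)
  rw [Functor.map_comp, Functor.map_comp, Category.assoc, Category.assoc]
  exact congr((toO O J (n + 1)).map (M.trans n) ≫
    $((restrictCompToO O J n).hom.naturality b)).trans h.symm

instance : (toInvSystem O J).Full where
  map_surjective {M N} g := by
    choose a ha using fun n => (toO O J n).map_surjective (X := M.obj n) (Y := N.obj n) (g.app (op n))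
    refine ⟨{ app := a, comm := fun n => comm_of_step n _ _ ?_ },
      NatTrans.ext (funext fun n => ha n.unop)⟩
    have h := InvSystem.app_tr g n.le_succ
    rw [tr_succ, tr_succ] at h
    rw [ha, ha]
    exact h

instance : PreservesFiniteLimits (toInvSystem O J) where
  preservesFiniteLimits K _ _ := preservesLimitsOfShape_of_evaluation _ _ fun n =>
    have : PreservesLimitsOfShape K
      (ProjSystem.ev (LambdaSheaf O J) (lambdaRestrict O J) n.unop) := inferInstance
    have : PreservesLimitsOfShape K (toO O J n.unop) := inferInstance
    comp_preservesLimitsOfShape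
      (ProjSystem.ev (LambdaSheaf O J) (lambdaRestrict O J) n.unop) (toO O J n.unop)

instance : PreservesFiniteColimits (toInvSystem O J) where
  preservesFiniteColimits K _ _ := preservesColimitsOfShape_of_evaluation _ _ fun n =>
    have : PreservesColimitsOfShape K
      (ProjSystem.ev (LambdaSheaf O J) (lambdaRestrict O J) n.unop) := inferInstance
    have : PreservesColimitsOfShape K (toO O J n.unop) := inferInstance
    comp_preservesColimitsOfShape
      (ProjSystem.ev (LambdaSheaf O J) (lambdaRestrict O J) n.unop) (toO O J n.unop)

end LambdaMod

namespace InvSystem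

open Opposite ZeroObject

variable {A : Type u} [Category.{v} A] [Abelian A] {R : Type w} [CommRing R] [Linear R A] {c : R}

lemma isAdic.of_iso {M N : ℕᵒᵖ ⥤ A} (hM : isAdic A c M) (e : M ≅ N) : isAdic A c N where
  bounded := (isBounded A c).prop_of_epi e.hom hM.bounded
  epi n := by
    have := hM.epi n
    exact epi_of_epi_fac (app_tr e.hom n.le_succ).symm.symm
  noetherian n := isNoetherianObject.prop_of_epi (e.hom.app (op n)) (hM.noetherian n)
  kernelBound n T x hx := by
    obtain ⟨T', p, hp, y, hy⟩ := hM.kernelBound n (x ≫ e.inv.app _) (by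
      rw [Category.assoc, app_tr, reassoc_of% hx, zero_comp])
    refine ⟨T', p, hp, y ≫ e.hom.app _, ?_⟩
    rw [← Linear.smul_comp, ← hy]
    simp

lemma isAdic_of_isZero {M : ℕᵒᵖ ⥤ A} (hM : IsZero M) : isAdic A c M where
  bounded n := (hM.obj (op n)).eq_of_src _ _
  epi n := ⟨fun _ _ _ => (hM.obj (op n)).eq_of_src _ _⟩
  noetherian n := isNoetherianObject.prop_of_isZero (hM.obj (op n))
  kernelBound _ T _ _ := ⟨T, 𝟙 T, inferInstance, 0, (hM.obj _).eq_of_tgt _ _⟩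

lemma isNull_le_isARAdic : isNull A ≤ isARAdic A c := fun _ hM =>
  ⟨0, 0, isAdic_of_isZero (isZero_zero _),
    (isNull A).prop_of_mono (kernel.ι _) ((isNull A).prop_of_isZero (isZero_zero _)),
    (isNull A).prop_of_epi (cokernel.π _) hM⟩

end InvSystem

/-! ### Adic and AR-adic modules over `Λ_•` -/

namespace LambdaMod

open Opposite

variable {O : Type u} [CommRing O] [IsLocalRing O] {C : Type u} [SmallCategory C]
  {J : GrothendieckTopology C}

variable (O J) in
lemma isARNull_eq_inverseImage :
    isARNull O J = (InvSystem.isNull (Sheaf J (ModuleCat.{u} O))).inverseImage (toInvSystem O J) := by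
  ext M
  exact exists_congr fun r => forall_congr' fun n => by
    rw [← tr_eq_transition]
    rfl

instance : (isARNull O J).IsSerreClass := by
  rw [isARNull_eq_inverseImage]
  infer_instance

lemma isARNull_iff_of_iso {M : LambdaMod O J} {Y : ℕᵒᵖ ⥤ Sheaf J (ModuleCat.{u} O)}
    (e : (toInvSystem O J).obj M ≅ Y) : isARNull O J M ↔ InvSystem.isNull _ Y := by
  rw [isARNull_eq_inverseImage]
  exact (InvSystem.isNull _).prop_iff_of_iso e

lemma isARNull_kernel_cokernel_iff {M N : LambdaMod O J} (f : M ⟶ N) :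
    isARNull O J (kernel f) ∧ isARNull O J (cokernel f) ↔
      (InvSystem.isNull (Sheaf J (ModuleCat.{u} O))).isoModSerre ((toInvSystem O J).map f) :=
  and_congr (isARNull_iff_of_iso (PreservesKernel.iso (toInvSystem O J) f))
    (isARNull_iff_of_iso (PreservesCokernel.iso (toInvSystem O J) f))

variable {ϖ : O} (hϖ : IsLocalRing.maximalIdeal O = Ideal.span {ϖ})

include hϖ

lemma smul_id_toO_obj (n : ℕ) (F : LambdaSheaf O J n) :
    ϖ ^ (n + 1) • 𝟙 ((toO O J n).obj F) = 0 :=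
  smul_id_sheafRestrict_obj _ J
    (Ideal.pow_mem_pow (hϖ ▸ Ideal.mem_span_singleton_self ϖ) (n + 1)) F

lemma exists_iso_toO_obj (n : ℕ) (F : Sheaf J (ModuleCat.{u} O)) (hF : ϖ ^ (n + 1) • 𝟙 F = 0) :
    ∃ G, Nonempty ((toO O J n).obj G ≅ F) :=
  exists_iso_sheafRestrict_obj _ J F fun c hc => by
    rw [hϖ, Ideal.span_singleton_pow, Ideal.mem_span_singleton] at hc
    obtain ⟨d, rfl⟩ := hc
    rw [mul_comm, mul_smul, hF, smul_zero]

lemma isBounded_toInvSystem (M : LambdaMod O J) :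
    InvSystem.isBounded _ ϖ ((toInvSystem O J).obj M) :=
  fun n => smul_id_toO_obj hϖ n (M.obj n)

lemma exists_iso_toInvSystem_obj (Y : ℕᵒᵖ ⥤ Sheaf J (ModuleCat.{u} O))
    (hY : InvSystem.isBounded _ ϖ Y) : ∃ M, Nonempty ((toInvSystem O J).obj M ≅ Y) := by
  choose G e using fun n => exists_iso_toO_obj hϖ n (Y.obj (op n)) (hY n)
  let i (n : ℕ) : (toO O J n).obj (G n) ≅ Y.obj (op n) := (e n).some
  let t (n : ℕ) : (toO O J (n + 1)).obj (G (n + 1)) ⟶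
      (toO O J (n + 1)).obj ((lambdaRestrict O J n).obj (G n)) :=
    (i (n + 1)).hom ≫ InvSystem.tr Y n.le_succ ≫ (i n).inv ≫ (restrictCompToO O J n).inv.app (G n)
  let M : LambdaMod O J := { obj := G, trans := fun n => (toO O J (n + 1)).preimage (t n) }
  have hM (n : ℕ) : M.step n = (i (n + 1)).hom ≫ InvSystem.tr Y n.le_succ ≫ (i n).inv := by
    rw [step_eq]
    refine (congr($((toO O J (n + 1)).map_preimage (t n)) ≫
      (restrictCompToO O J n).hom.app (G n))).trans ?_
    simp only [t, Category.assoc]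
    erw [Iso.inv_hom_id_app]
    simp
  let φ : (toInvSystem O J).obj M ⟶ Y := NatTrans.ofOpSequence (fun n => (i n).hom) fun n => by
    refine congr($((tr_succ M n).trans (hM n)) ≫ (i n).hom).trans ?_
    have : ((i (n + 1)).hom ≫ InvSystem.tr Y n.le_succ ≫ (i n).inv) ≫ (i n).hom =
      (i (n + 1)).hom ≫ InvSystem.tr Y n.le_succ := by simp
    exact this
  have (n : ℕᵒᵖ) : IsIso (φ.app n) := inferInstanceAs (IsIso (i n.unop).hom)
  have : IsIso φ := NatIso.isIso_of_isIso_app φ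
  exact ⟨M, ⟨asIso φ⟩⟩

lemma isIso_homEquiv_symm_trans_iff (M : LambdaMod O J) (n : ℕ) :
    IsIso (((lambdaAdj O J n).homEquiv (M.obj (n + 1)) (M.obj n)).symm (M.trans n)) ↔
      Epi (M.step n) ∧ ∀ {T : Sheaf J (ModuleCat.{u} O)}
        (x : T ⟶ (toO O J (n + 1)).obj (M.obj (n + 1))), x ≫ M.step n = 0 →
        ∃ (T' : Sheaf J (ModuleCat.{u} O)) (p : T' ⟶ T) (_ : Epi p)
          (y : T' ⟶ (toO O J (n + 1)).obj (M.obj (n + 1))), p ≫ x = ϖ ^ (n + 1) • y :=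
  isIso_homEquiv_symm_iff (toO O J n) (smul_id_toO_obj hϖ n) (toO O J (n + 1)) (lambdaAdj O J n)
    (restrictCompToO O J n) (M.trans n) (exists_iso_toO_obj hϖ n)

lemma isNoetherianObject_toO_obj_iff {n : ℕ} {X : LambdaSheaf O J n} :
    isNoetherianObject ((toO O J n).obj X) ↔ isNoetherianObject X :=
  ⟨isNoetherianObject_of_map _, isNoetherianObject_map _ fun {Y} i _ => exists_iso_toO_obj hϖ n Y (by
    rw [← cancel_mono i, zero_comp, Linear.smul_comp, Category.id_comp, ← Category.comp_id i,
      ← Linear.comp_smul, smul_id_toO_obj hϖ, comp_zero])⟩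

lemma isAdic_iff (M : LambdaMod O J) :
    isAdic O J M ↔ InvSystem.isAdic _ ϖ ((toInvSystem O J).obj M) := by
  constructor
  · intro h
    exact
      { bounded := isBounded_toInvSystem hϖ M
        epi := fun n => by
          rw [tr_succ]
          exact ((isIso_homEquiv_symm_trans_iff hϖ M n).1 (h.1 n)).1
        kernelBound := fun n _ x hx =>
          ((isIso_homEquiv_symm_trans_iff hϖ M n).1 (h.1 n)).2 x (by
            rw [← tr_succ]
            exact hx)
        noetherian := fun n =>
          (isNoetherianObject_toO_obj_iff hϖ).2 (h.2 n).prop }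
  · intro h
    refine ⟨fun n => (isIso_homEquiv_symm_trans_iff hϖ M n).2 ⟨?_, fun x hx => ?_⟩, fun n =>
      ⟨(isNoetherianObject_toO_obj_iff hϖ).1 (h.noetherian n)⟩⟩
    · rw [← tr_succ]
      exact h.epi n
    · rw [← tr_succ] at hx
      exact h.kernelBound n x hx

variable (J) in
lemma isARAdic_eq_inverseImage :
    isARAdic O J = (InvSystem.isARAdic _ ϖ).inverseImage (toInvSystem O J) := by
  ext M
  constructor
  · rintro ⟨N, f, hN, hf⟩
    exact ⟨_, (toInvSystem O J).map f, (isAdic_iff hϖ N).1 hN, (isARNull_kernel_cokernel_iff f).1 hf⟩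
  · rintro ⟨Y, f, hY, hf⟩
    obtain ⟨N, ⟨e⟩⟩ := exists_iso_toInvSystem_obj hϖ Y hY.bounded
    refine ⟨N, (toInvSystem O J).preimage (e.hom ≫ f), (isAdic_iff hϖ N).2 (hY.of_iso e.symm),
      (isARNull_kernel_cokernel_iff _).2 ?_⟩
    rw [Functor.map_preimage]
    exact MorphismProperty.comp_mem _ _ _ (ObjectProperty.isoModSerre_of_isIso _ _) hf

lemma isARNull_le_isARAdic : isARNull O J ≤ isARAdic O J := by
  rw [isARAdic_eq_inverseImage J hϖ, isARNull_eq_inverseImage]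
  exact fun _ h => InvSystem.isNull_le_isARAdic _ h

lemma isThickSubcategory_isARAdic : IsThickSubcategory (isARAdic O J) := by
  have := isARNull_le_isARAdic (J := J) hϖ
  rw [isARAdic_eq_inverseImage J hϖ] at this ⊢
  obtain ⟨Z, hZ, hZ'⟩ := (isARNull O J).exists_prop_of_containsZero
  exact
    { exists_zero := ⟨Z, hZ, this _ hZ'⟩
      kernels_le := by
        rintro _ ⟨f, k, hk, hf⟩
        exact (InvSystem.isARAdic _ ϖ).prop_of_iso ((PreservesKernel.iso (toInvSystem O J) f).symm ≪≫
          (toInvSystem O J).mapIso ((kernelIsKernel f).conePointUniqueUpToIso hk))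
          (InvSystem.isARAdic.prop_kernel hf.1 hf.2 _)
      cokernels_le := by
        rintro _ ⟨f, k, hk, hf⟩
        exact (InvSystem.isARAdic _ ϖ).prop_of_iso
          ((PreservesCokernel.iso (toInvSystem O J) f).symm ≪≫
            (toInvSystem O J).mapIso ((cokernelIsCokernel f).coconePointUniqueUpToIso hk))
          (InvSystem.isARAdic.prop_cokernel hf.1 hf.2 _)
      prop_X₂_of_shortExact := fun hS h₁ h₃ =>
        InvSystem.isARAdic.of_shortExact (hS.map_of_exact (toInvSystem O J)) h₁
          (isBounded_toInvSystem hϖ _) h₃ }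

end LambdaMod

theorem mainTheorem10 {O : Type u} [CommRing O] [IsDomain O] [IsDiscreteValuationRing O]
    [IsAdicComplete (IsLocalRing.maximalIdeal O) O]
    {C : Type u} [SmallCategory C] (J : GrothendieckTopology C)
    [HasDerivedCategory.{w} (LambdaMod O J)] :
    IsThickSubcategory (LambdaMod.isARAdic O J) ∧
    ((LambdaMod.isARNull O J).IsSerreClass ∧
      LambdaMod.isARNull O J ≤ LambdaMod.isARAdic O J) ∧
    (IsThickTriangulated (cohomologyIn (LambdaMod.isARAdic O J)) ∧
      IsThickTriangulated (cohomologyIn (LambdaMod.isARNull O J)) ∧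
      cohomologyIn (LambdaMod.isARNull O J) ≤ cohomologyIn (LambdaMod.isARAdic O J)) := by
  obtain ⟨ϖ, hϖ⟩ := IsDiscreteValuationRing.exists_irreducible O
  have h := hϖ.maximalIdeal_eq
  have h₁ : IsThickSubcategory (LambdaMod.isARAdic O J) := LambdaMod.isThickSubcategory_isARAdic h
  have h₂ := LambdaMod.isARNull_le_isARAdic (J := J) h
  exact ⟨h₁, ⟨inferInstance, h₂⟩, inferInstance, inferInstance, fun _ hK i => h₂ _ (hK i)⟩
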